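/- **Setting.** Let $D$ be a finite set of distinct words over an alphabet of size $\sigma\ge 2$, given as a list, and let $n$ be the total length of the words. Let $\phi$ be a wild card symbol. The *substitution list* of $p\phi v$ is the set of characters $a$ with $pav\in D$. Fix a load factor $0<\alpha<1$; a hash table for $N$ elements has $t=\lceil N/\alpha\rceil$ slots and uses linear probing: an element with hash value $h$ is put in the first empty slot among $h \bmod t, (h\bmod t)+1,\dots$ (cyclically). The *one-error dictionary* for $D$ consists of * an *exact dictionary*: for each length $\ell$, a hash table holding the words of $D$ of length $\ell$, each word $x$ inserted with hash value $h(x)$; a search scans slots until the word or an empty slot is found; * a *substitution store*: one hash table in which, for every $x\in D$ and every position $j$, the character $x[j]$ is inserted with hash value $h(x[1..j-1]\,\phi\, x[j+1..|x|])$, together with an $r$-bit signature computed from that hash value ($r\ge 0$ a constant). Looking up a string with one wild card collects the characters with matching signature from the slots up to the first empty one. Optionally, all tables are compacted after construction: only the non-empty slots are kept, together with a bit vector marking them, with the number of ones sampled at the start of every block of $\delta\ge 1$ machine words for rank queries ($\delta$ a constant). A query for $x$ of length $m$ looks up in the exact dictionary: $x$ itself; every word obtained from $x$ by deleting a character; and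 every word obtained by putting, in place of the wild card, a character collected from the substitution store for the strings $x[1..j-1]\,\phi\, x[j+1..m]$ ($1\le j\le m$) and $x[1..j]\,\phi\, x[j+1..m]$ ($0\le j\le m$). It reports the words found. **Cost model.** Time is counted in steps of a RAM with word length $w\ge 1$, $w=\Omega(\log n)$. Reading or writing a slot entry's character or signature, an arithmetic instruction, a population count, and updating the candidate word in its buffer (at most two characters change from one candidate to the next) take constant time; writing a word of length $\ell$ takes $O(\ell+1)$; comparing two words of length $\ell$ takes one step per machine word of their packed representations, $\lceil \ell\lceil\log_2\sigma\rceil/w\rceil$ steps, plus a constant. **Assumptions.** 1. *Incremental hashing*: after preprocessing of a string $x$ in time $O(|x|+1)$, the hash value of any string (over the alphabet with $\phi$) at edit distance at most one from $x$ is computed in constant time. 2. *Fully random hashing*: the hash values of distinct strings are independent, and each is uniform on $\{0,\dots,R-1\}$, where $R\ge 1$ depends only on the hash table in which the string is used and is a multiple of the number of slots of that table whenever the table is to hold at least one element. 3. Every non-empty substitution list has exactly one element. **Theorem.** There is a constant $C$ depending only on $\alpha$, $\delta$, $r$ and the constants in the assumptions on hashing time and on $w$ such that, for all such $D$: * for every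 outcome of the hash function and every word $x$, the query for $x$ reports exactly the words of $D$ at edit distance (insertions, deletions, substitutions, unit costs) at most one from $x$; * for every word $x$ of length $m\ge 1$, the expected time of the query for $x$ is at most $C\, m\lceil \frac{m\log_2\sigma}{w}\rceil$; * if $n\ge 1$, the expected construction time is at most $C\,n$. All of this holds with and without compaction. Expectations are over the hash function only. -/

import Mathlib

open MeasureTheory ProbabilityTheory
open scoped ENNReal

/-! ## Counting steps -/

/-- A result together with the number of word-RAM steps spent to obtain it. -/
structure Timed (A : Type) where
  val : A
  time : ℕ

instance : Monad Timed where
  pure a := ⟨a, 0⟩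
  bind p f := ⟨(f p.val).val, p.time + (f p.val).time⟩

/-- Spend `k` steps. -/
def tick (k : ℕ) : Timed Unit := ⟨(), k⟩

/-! ## Words, edit distance, substitution lists -/

/-- Words over the alphabet of size `σ`. -/
abbrev Word (σ : ℕ) := List (Fin σ)

/-- One insertion, deletion or substitution of a character. -/
inductive EditStep {A : Type} : List A → List A → Prop
  | insert (u v : List A) (a : A) : EditStep (u ++ v) (u ++ a :: v)
  | delete (u v : List A) (a : A) : EditStep (u ++ a :: v) (u ++ v)
  | subst (u v : List A) (a b : A) : EditStep (u ++ a :: v) (u ++ b :: v)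

/-- `EditDistLE k x y`: the (unit-cost) edit distance of `x` and `y` is at most `k`, that is,
`y` is obtained from `x` by a sequence of at most `k` edit operations. -/
def EditDistLE {A : Type} : ℕ → List A → List A → Prop
  | 0, x, y => x = y
  | k + 1, x, y => EditDistLE k x y ∨ ∃ z, EditDistLE k x z ∧ EditStep z y

/-- Strings over the alphabet extended by the wild card `φ`, written `none`. -/
abbrev Key (σ : ℕ) := List (Option (Fin σ))

/-- A word, as a string without wild card. -/
def plainKey {σ : ℕ} (x : Word σ) : Key σ := x.map some

/-- `x` with its character number `i` (counted from `0`) replaced by the wild card. -/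
def substKey {σ : ℕ} (x : Word σ) (i : ℕ) : Key σ := (plainKey x).set i none

/-- `x` with a wild card inserted just before its character number `i`. -/
def insertKey {σ : ℕ} (x : Word σ) (i : ℕ) : Key σ := (plainKey x).insertIdx i none

/-- The substitution list of `p φ v`: the characters `a` for which `p a v` is in the dictionary. -/
def substList {σ : ℕ} (D : List (Word σ)) (p v : Word σ) : Finset (Fin σ) :=
  Finset.univ.filter fun a => p ++ a :: v ∈ D

/-- The total length of the dictionary words. -/
def totalLength {σ : ℕ} (D : List (Word σ)) : ℕ := (D.map List.length).sum

/-- The number of dictionary words of length `l`. -/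
def countLength {σ : ℕ} (D : List (Word σ)) (l : ℕ) : ℕ := D.countP fun x => x.length = l

/-! ## Hashing -/

/-- A string hash function, with the time `preCost x` it takes to preprocess a string `x`, and
the time `evalCost x y` that it then takes to compute the hash value of the string `y`. -/
structure HashOracle (σ : ℕ) where
  hash : Key σ → ℕ
  preCost : Key σ → ℕ
  evalCost : Key σ → Key σ → ℕ

/-- Incremental hashing with constant `c`: after a linear-time preprocessing of `x`, the hash
value of any string at distance at most one from `x` is computed in constant time. -/
def IsIncremental {σ : ℕ} (c : ℕ) (preCost : Key σ → ℕ) (evalCost : Key σ → Key σ → ℕ) : Prop :=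
  ∀ x, preCost x ≤ c * (x.length + 1) ∧ ∀ y, EditDistLE 1 x y → evalCost x y ≤ c

/-- A fully random hash function `h`, the value `h u` ranging over `{0, …, R u - 1}`: the values
of the distinct keys `u` are independent and each is uniformly distributed on its range. -/
def FullyRandom {U Ω : Type*} [MeasurableSpace Ω] (P : Measure Ω) (R : U → ℕ)
    (h : U → Ω → ℕ) : Prop :=
  (∀ u, Measurable (h u)) ∧
  (∀ u, 0 < R u ∧ ∀ v < R u, P (h u ⁻¹' {v}) = (R u : ℝ≥0∞)⁻¹) ∧
  iIndepFun h P

/-- The ranges of the hash values: `RS` for the keys of the substitution store (the strings with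
a wild card), `RE l` for those of the hash table of the words of length `l`. -/
def hashRange {σ : ℕ} (RS : ℕ) (RE : ℕ → ℕ) (k : Key σ) : ℕ :=
  if none ∈ k then RS else RE k.length

def HashOracle.preprocess {σ : ℕ} (O : HashOracle σ) (x : Word σ) : Timed Unit :=
  tick (O.preCost (plainKey x))

/-- The hash value of `k`, computed after preprocessing `x`. -/
def HashOracle.eval {σ : ℕ} (O : HashOracle σ) (x : Word σ) (k : Key σ) : Timed ℕ :=
  ⟨O.hash k, O.evalCost (plainKey x) k⟩

/-! ## Linear probing tables -/

/-- A hash table with slots `0, …, size - 1`; the empty slots hold `none`. -/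
structure Table (E : Type) where
  size : ℕ
  slot : ℕ → Option E

/-- The slot after `i`, cyclically. -/
def nextSlot (size i : ℕ) : ℕ := if i + 1 = size then 0 else i + 1

/-- Allocate a table and mark all of its slots as empty. -/
def Table.alloc {E : Type} (size : ℕ) : Timed (Table E) := do
  tick (size + 1)
  pure ⟨size, fun _ => none⟩

/-- Write `e`, at the cost of `writeCost e` steps, into the first empty slot from slot `i` on.
The first numerical argument bounds the number of slots that are examined. -/
def Table.probe {E : Type} (writeCost : E → ℕ) (T : Table E) (e : E) :
    ℕ → ℕ → Timed (Table E)
  | 0, _ => pure T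
  | k + 1, i => do
    tick 1
    match T.slot i with
    | none => do
      tick (writeCost e)
      pure { T with slot := Function.update T.slot i (some e) }
    | some _ => Table.probe writeCost T e k (nextSlot T.size i)

/-- Insert `e`, whose hash value is `hv`. -/
def Table.insert {E : Type} (writeCost : E → ℕ) (T : Table E) (e : E) (hv : ℕ) :
    Timed (Table E) := do
  tick 1
  T.probe writeCost e T.size (hv % T.size)

/-! ## Compaction -/

/-- A compacted table: a bit vector marking the non-empty slots, the number of ones before every
block of `δ` words of that vector, and the contents of the `count` non-empty slots in order. -/
structure CTable (E : Type) where
  size : ℕ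
  bit : ℕ → Bool
  sample : ℕ → ℕ
  entry : ℕ → Option E
  count : ℕ

/-- Process slot number `i` of the table that is being compacted. -/
def compactStep {E : Type} (δ w : ℕ) (writeCost : E → ℕ) (T : Table E) (C : CTable E) (i : ℕ) :
    Timed (CTable E) := do
  tick 1
  let C' : CTable E ←
    if i % (δ * w) = 0 then do
      tick 1
      pure { C with sample := Function.update C.sample (i / (δ * w)) C.count }
    else pure C
  match T.slot i with
  | none => pure C'
  | some e => do
    tick (2 + writeCost e)
    pure { C' with
      bit := Function.update C'.bit i true
      entry := Function.update C'.entry C'.count (some e)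
      count := C'.count + 1 }

def Table.compact {E : Type} (δ w : ℕ) (writeCost : E → ℕ) (T : Table E) : Timed (CTable E) := do
  tick 1
  (List.range T.size).foldlM (compactStep δ w writeCost T)
    ⟨T.size, fun _ => false, fun _ => 0, fun _ => none, 0⟩

/-- The number of ones among the `len` bits from bit `a` on; a single (masked) population count
instruction if those bits lie in one machine word. -/
def popcount (bit : ℕ → Bool) (a len : ℕ) : ℕ :=
  ((List.range len).filter fun j => bit (a + j)).length

/-- The number of ones before bit `i`: one sampled count and at most `δ` population counts. -/
def CTable.rank {E : Type} (δ w : ℕ) (C : CTable E) (i : ℕ) : Timed ℕ := do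
  tick 1
  let b := i / (δ * w)
  let s ← (List.range (i / w - b * δ)).foldlM
    (fun s j => do
      tick 1
      pure (s + popcount C.bit ((b * δ + j) * w) w))
    (C.sample b)
  tick 1
  pure (s + popcount C.bit (i / w * w) (i % w))

/-- A finished hash table, compacted or not. -/
inductive Store (E : Type) where
  | plain (T : Table E)
  | compacted (C : CTable E)

def Store.size {E : Type} : Store E → ℕ
  | .plain T => T.size
  | .compacted C => C.size

/-- Start a scan at slot `i`. The scan keeps the number of the current slot and, in a compacted
table, the number of non-empty slots before it. -/
def Store.start {E : Type} (δ w : ℕ) (S : Store E) (i : ℕ) : Timed (ℕ × ℕ) :=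
  match S with
  | .plain _ => do
    tick 1
    pure (i, 0)
  | .compacted C => do
    let k ← C.rank δ w i
    pure (i, k)

/-- Read the current slot. -/
def Store.read {E : Type} (S : Store E) (q : ℕ × ℕ) : Timed (Option E) :=
  match S with
  | .plain T => do
    tick 1
    pure (T.slot q.1)
  | .compacted C => do
    tick 2
    pure (if C.bit q.1 then C.entry q.2 else none)

/-- Step from a non-empty slot to the next one, cyclically. -/
def Store.advance {E : Type} (S : Store E) (q : ℕ × ℕ) : Timed (ℕ × ℕ) := do
  tick 1
  pure (if q.1 + 1 = S.size then (0, 0) else (q.1 + 1, q.2 + 1))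

/-- Collect the contents of the successive slots up to the first empty one. -/
def Store.collect {E : Type} (S : Store E) : ℕ → ℕ × ℕ → Timed (List E)
  | 0, _ => pure []
  | k + 1, q => do
    let r ← S.read q
    match r with
    | none => pure []
    | some e => do
      let q' ← S.advance q
      let l ← Store.collect S k q'
      pure (e :: l)

/-- The number of machine words, of `w` bits each, taken by a packed word of length `m` over an
alphabet of size `σ`, that is `⌈m ⌈log₂ σ⌉ / w⌉`. -/
def packedLength (σ w m : ℕ) : ℕ := (m * Nat.clog 2 σ + w - 1) / w

/-- Examine the successive slots until `y` or an empty slot is found. Each comparison of `y` with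
the contents of a slot (a word of the same length) compares the packed words machine word by
machine word. -/
def Store.search {σ : ℕ} (w : ℕ) (S : Store (Word σ)) (y : Word σ) : ℕ → ℕ × ℕ → Timed Bool
  | 0, _ => pure false
  | k + 1, q => do
    let r ← S.read q
    match r with
    | none => pure false
    | some z => do
      tick (1 + packedLength σ w y.length)
      if z = y then pure true
      else do
        let q' ← S.advance q
        Store.search w S y k q'

/-! ## The one-error dictionary -/

/-- The parameters of the data structure: the load factor of the hash tables, the number `δ` of
machine words per sample of the rank structure, the word length `w`, whether the tables are
compacted, and the signature function, which maps hash values to `r`-bit signatures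
(`r = 0`: no signatures). -/
structure Params (r : ℕ) where
  loadFactor : ℝ
  δ : ℕ
  w : ℕ
  compaction : Bool
  sig : ℕ → Fin (2 ^ r)

/-- The number of slots of a table that is to hold `N` elements. -/
noncomputable def capacity (loadFactor : ℝ) (N : ℕ) : ℕ := ⌈(N : ℝ) / loadFactor⌉₊

/-- The exact dictionary (a hash table for each word length up to `maxLen`), and the substitution
store, whose elements are pairs of a character and a signature. -/
structure OneErrorDict (σ r : ℕ) where
  maxLen : ℕ
  exact : ℕ → Store (Word σ)
  subst : Store (Fin σ × Fin (2 ^ r))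

/-- Turn a table into its final form. -/
def Table.finish {E : Type} {r : ℕ} (p : Params r) (writeCost : E → ℕ) (T : Table E) :
    Timed (Store E) :=
  if p.compaction then do
    let C ← T.compact p.δ p.w writeCost
    pure (.compacted C)
  else do
    tick 1
    pure (.plain T)

/-- Insert the word `x` into the exact dictionary, and every character of `x` into the
substitution store. Writing a word takes one step per character. -/
def insertWord {σ r : ℕ} (p : Params r) (O : HashOracle σ)
    (s : (ℕ → Table (Word σ)) × Table (Fin σ × Fin (2 ^ r))) (x : Word σ) :
    Timed ((ℕ → Table (Word σ)) × Table (Fin σ × Fin (2 ^ r))) := do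
  O.preprocess x
  let hv ← O.eval x (plainKey x)
  let T ← (s.1 x.length).insert (fun y => y.length + 1) x hv
  let S ← x.zipIdx.foldlM
    (fun S aj => do
      let hj ← O.eval x (substKey x aj.2)
      tick 1
      S.insert (fun _ => 1) (aj.1, p.sig hj) hj)
    s.2
  pure (Function.update s.1 x.length T, S)

/-- The construction of the data structure for the dictionary `D`. -/
noncomputable def build {σ r : ℕ} (p : Params r) (O : HashOracle σ) (D : List (Word σ)) :
    Timed (OneErrorDict σ r) := do
  -- total and maximal length, and number of words of each length
  let nL ← D.foldlM
    (fun (s : ℕ × ℕ) x => do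
      tick (x.length + 1)
      pure (s.1 + x.length, max s.2 x.length))
    (0, 0)
  tick (nL.2 + 1)
  let cnt ← D.foldlM
    (fun (f : ℕ → ℕ) x => do
      tick 1
      pure (Function.update f x.length (f x.length + 1)))
    (fun _ => 0)
  -- empty tables
  let tables ← (List.range (nL.2 + 1)).foldlM
    (fun (f : ℕ → Table (Word σ)) l => do
      let T ← Table.alloc (capacity p.loadFactor (cnt l))
      pure (Function.update f l T))
    (fun _ => ⟨0, fun _ => none⟩)
  let store ← Table.alloc (capacity p.loadFactor nL.1)
  -- insertions
  let s ← D.foldlM (insertWord p O) (tables, store)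
  -- final form
  let exact ← (List.range (nL.2 + 1)).foldlM
    (fun (f : ℕ → Store (Word σ)) l => do
      let S ← (s.1 l).finish p (fun y => y.length + 1)
      pure (Function.update f l S))
    (fun _ => .plain ⟨0, fun _ => none⟩)
  let subst ← s.2.finish p (fun _ => 1)
  pure ⟨nL.2, exact, subst⟩

/-- Is the word `y` in the dictionary? (The string `x` has been preprocessed.) -/
def OneErrorDict.contains {σ r : ℕ} (Q : OneErrorDict σ r) (p : Params r) (O : HashOracle σ)
    (x y : Word σ) : Timed Bool := do
  tick 1
  if Q.maxLen < y.length ∨ (Q.exact y.length).size = 0 then pure false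
  else do
    let hv ← O.eval x (plainKey y)
    let S := Q.exact y.length
    let q ← S.start p.δ p.w (hv % S.size)
    S.search p.w y S.size q

/-- Report the candidate `y` if it is in the dictionary. -/
def OneErrorDict.check {σ r : ℕ} (Q : OneErrorDict σ r) (p : Params r) (O : HashOracle σ)
    (x y : Word σ) : Timed (List (Word σ)) := do
  let b ← Q.contains p O x y
  tick 1
  pure (if b then [y] else [])

/-- The characters that the substitution store returns for the string `k` with a wild card:
those found in the slots from the hash value of `k` up to the first empty slot, as far as their
signature is that of `k`. -/
def OneErrorDict.candidates {σ r : ℕ} (Q : OneErrorDict σ r) (p : Params r) (O : HashOracle σ)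
    (x : Word σ) (k : Key σ) : Timed (List (Fin σ)) := do
  tick 1
  if Q.subst.size = 0 then pure []
  else do
    let hv ← O.eval x k
    let q ← Q.subst.start p.δ p.w (hv % Q.subst.size)
    let l ← Q.subst.collect Q.subst.size q
    tick (1 + l.length)
    pure ((l.filter fun e => e.2 = p.sig hv).map Prod.fst)

/-- Check a list of candidates one after the other. The candidate is kept in a buffer; each one
differs from the preceding contents of the buffer in at most two characters, hence the two
steps charged for updating the buffer. -/
def OneErrorDict.checkAll {σ r : ℕ} (Q : OneErrorDict σ r) (p : Params r) (O : HashOracle σ)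
    (x : Word σ) (cands : List (Word σ)) : Timed (List (Word σ)) :=
  cands.foldlM
    (fun out y => do
      tick 2
      let l ← Q.check p O x y
      pure (out ++ l))
    []

/-- The query: report all dictionary words at edit distance at most one from `x`. After
preprocessing `x` and copying it to three buffers (one for each kind of edit operation), check
`x`, the deletions, the substitutions and the insertions. The two steps charged per position are
those of updating the buffer when passing to the next position. -/
def OneErrorDict.query {σ r : ℕ} (Q : OneErrorDict σ r) (p : Params r) (O : HashOracle σ)
    (x : Word σ) : Timed (List (Word σ)) := do
  O.preprocess x
  tick (3 * (x.length + 1))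
  let out₀ ← Q.check p O x x
  let out₁ ← Q.checkAll p O x ((List.range x.length).map fun i => x.eraseIdx i)
  let out₂ ← (List.range x.length).foldlM
    (fun out i => do
      tick 2
      let l ← Q.candidates p O x (substKey x i)
      let res ← Q.checkAll p O x (l.map fun a => x.set i a)
      pure (out ++ res))
    []
  let out₃ ← (List.range (x.length + 1)).foldlM
    (fun out i => do
      tick 2
      let l ← Q.candidates p O x (insertKey x i)
      let res ← Q.checkAll p O x (l.map fun a => x.insertIdx i a)
      pure (out ++ res))
    []
  pure (out₀ ++ out₁ ++ out₂ ++ out₃)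

/-!
The theorem combines a deterministic analysis of the data structure, valid for every outcome of
the hash function, with an estimate of the expected length of a run of full slots.

*Deterministic part.* A table built by linear probing satisfies the invariant `Table.Holds`: every
element is stored once, and all slots from the one given by its hash value up to the one holding it
are full. Hence a scan from the hash value up to the first empty slot (`Table.run`) meets the
element, and looking up `u φ v` in the substitution store collects `a` whenever `u a v` is in the
dictionary (`mem_candRun`); as every candidate is checked in the exact dictionary, the query is
correct (`OneErrorDict.query_spec`). Compaction does not change what a scan sees, since the rank of
a full slot is the index of its content (`Table.compact_spec`, `CTable.rank_spec`). All times are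
bounded by the lengths of runs. If the run from slot `q` has length greater than `l` and the full
slots extend over exactly `d` slots before `q`, then the elements in these `d + l + 1` slots all
have their hash values there; so the length of the run is at most the number `Table.runBound` of
pairs `(d, l)` whose arc of `d + l + 1` slots around `q` receives that many hash values
(`Table.Holds.run_length_le_runBound`). This number grows with the set of keys, so the one for the
complete table also bounds the cost of each insertion.

*Probabilistic part.* With load factor `α`, Chernoff's bound shows that an arc of `s` slots receives
`s` hash values with probability at most `ρ ^ s / α`, where `ρ = α * exp (1 - α) < 1`; the factor
`1 / α` allows for the key that is looked up being in the table. Summing over all pairs `(d, l)`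
gives an expected run length of at most `1 / (α * (1 - ρ) ^ 2)`
(`FullyRandom.lintegral_runBound_le`). As every substitution list has at most one element, the keys
in the substitution store are distinct, so that the estimate applies to it. The cost of a lookup is
a sum over the characters collected, and each summand is the product of a quantity depending on the
hash values of keys with a wild card (how often the character is collected) and one depending on
those of keys without (the cost of checking the candidate). These are independent, so a lookup has
a constant expected number of checks, each of expected cost `O(1 + ⌈m log₂ σ / w⌉)`
(`meanLE_lookupCost`).
-/


/-! ### The step-counting monad -/

namespace Timed

variable {A B S : Type}

@[simp] theorem val_pure (a : A) : (pure a : Timed A).val = a := rfl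

@[simp] theorem time_pure (a : A) : (pure a : Timed A).time = 0 := rfl

@[simp] theorem val_bind (p : Timed A) (f : A → Timed B) : (p >>= f).val = (f p.val).val := rfl

@[simp] theorem time_bind (p : Timed A) (f : A → Timed B) :
    (p >>= f).time = p.time + (f p.val).time := rfl

@[simp] theorem time_tick (k : ℕ) : (tick k).time = k := rfl

theorem bind_assoc {C : Type} (p : Timed A) (f : A → Timed B) (g : B → Timed C) :
    p >>= f >>= g = p >>= fun a => f a >>= g := by
  change Timed.mk _ (_ + _ + _) = Timed.mk _ (_ + (_ + _))
  rw [Nat.add_assoc]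
  rfl

/-- The computation `m` takes at most `t` steps and has a result satisfying `Q`. -/
def Spec (m : Timed A) (t : ℕ) (Q : A → Prop) : Prop := Q m.val ∧ m.time ≤ t

theorem Spec.bind {m : Timed A} {f : A → Timed B} {t₁ t₂ t : ℕ} {Q : A → Prop}
    {Q' : B → Prop} (h : m.Spec t₁ Q) (hf : ∀ a, Q a → (f a).Spec t₂ Q') (ht : t₁ + t₂ ≤ t) :
    (m >>= f).Spec t Q' := by
  obtain ⟨h1, h2⟩ := h
  obtain ⟨h3, h4⟩ := hf _ h1
  exact ⟨h3, by rw [Timed.time_bind]; omega⟩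

/-- The rule for loops: an invariant `I` relating the processed part of the list to the state
holds at the end, and the time is at most the sum of the time bounds of the iterations. -/
theorem foldlM_spec (f : S → A → Timed S) (b : A → ℕ) (I : List A → S → Prop) (l : List A)
    (h : ∀ l₁ a l₂ s, l = l₁ ++ a :: l₂ → I l₁ s →
      (f s a).Spec (b a) (I (l₁ ++ [a]))) (s : S) (hs : I [] s) :
    (l.foldlM f s).Spec (l.map b).sum (I l) := by
  suffices H : ∀ (l₂ l₁ : List A) (s : S), l = l₁ ++ l₂ → I l₁ s →
      (l₂.foldlM f s).Spec (l₂.map b).sum (I l) from H l [] s rfl hs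
  intro l₂
  induction l₂ with
  | nil => intro l₁ s hl hI; exact ⟨by simpa [hl] using hI, le_rfl⟩
  | cons a l₂ ih =>
    intro l₁ s hl hI
    obtain ⟨h1, h2⟩ := h l₁ a l₂ s hl hI
    obtain ⟨h3, h4⟩ := ih (l₁ ++ [a]) (f s a).val (by simp [hl]) h1
    rw [List.foldlM_cons, List.map_cons, List.sum_cons]
    exact ⟨h3, by rw [time_bind]; omega⟩

end Timed

/-! ### Linear probing -/

namespace Table

variable {E : Type}

/-- The table with `size` slots, all of them empty. -/
def empty (E : Type) (size : ℕ) : Table E := ⟨size, fun _ => none⟩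

/-- The contents of the slots from slot `i` on, up to the first empty one, but of at most `k`
slots. -/
def run (T : Table E) : ℕ → ℕ → List E
  | 0, _ => []
  | k + 1, i =>
    match T.slot i with
    | none => []
    | some e => e :: T.run k (nextSlot T.size i)

theorem nextSlot_eq_mod {t i : ℕ} (hi : i < t) : nextSlot t i = (i + 1) % t := by
  unfold nextSlot
  split_ifs with h
  · simp [h]
  · rw [Nat.mod_eq_of_lt (by omega)]

theorem run_length_le (T : Table E) (k i : ℕ) : (T.run k i).length ≤ k := by
  induction k generalizing i with
  | zero => simp [run]
  | succ k ih =>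
    unfold run
    split
    · simp
    · simpa using ih _

theorem slot_ne_none_of_lt_run_length (T : Table E) (k i : ℕ) (hi : i < T.size) (j : ℕ)
    (hj : j < (T.run k i).length) : T.slot ((i + j) % T.size) ≠ none := by
  induction k generalizing i j with
  | zero => simp [run] at hj
  | succ k ih =>
    unfold run at hj
    split at hj
    · simp at hj
    · rename_i e he
      rcases j with _ | j
      · simp [Nat.mod_eq_of_lt hi, he]
      · have := ih (nextSlot T.size i) (by rw [nextSlot_eq_mod hi]; exact Nat.mod_lt _ (by omega))
          j (by simpa using hj)
        rwa [nextSlot_eq_mod hi, Nat.mod_add_mod, Nat.add_assoc, Nat.add_comm 1 j] at this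

theorem slot_run_length (T : Table E) (k i : ℕ) (hi : i < T.size)
    (hk : (T.run k i).length < k) : T.slot ((i + (T.run k i).length) % T.size) = none := by
  induction k generalizing i with
  | zero => simp at hk
  | succ k ih =>
    unfold run at hk ⊢
    split
    · rename_i h
      simp [Nat.mod_eq_of_lt hi, h]
    · rename_i e he
      simp only [he] at hk
      have := ih (nextSlot T.size i) (by rw [nextSlot_eq_mod hi]; exact Nat.mod_lt _ (by omega))
        (by simpa using hk)
      generalize T.run k (nextSlot T.size i) = l at *
      rwa [nextSlot_eq_mod hi, Nat.mod_add_mod, Nat.add_assoc, Nat.add_comm 1] at this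

theorem mem_run (T : Table E) (k i : ℕ) (hi : i < T.size) (d : ℕ) (hd : d < k) (e : E)
    (he : T.slot ((i + d) % T.size) = some e)
    (hf : ∀ d' ≤ d, T.slot ((i + d') % T.size) ≠ none) : e ∈ T.run k i := by
  induction k generalizing i d with
  | zero => omega
  | succ k ih =>
    unfold run
    have h0 := hf 0 (by omega)
    rw [Nat.add_zero, Nat.mod_eq_of_lt hi] at h0
    split
    · exact absurd ‹_› h0
    · rename_i e' he'
      rcases d with _ | d
      · rw [Nat.add_zero, Nat.mod_eq_of_lt hi, he'] at he
        simp_all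
      · have key : ∀ j, (nextSlot T.size i + j) % T.size = (i + (j + 1)) % T.size := by
          intro j
          rw [nextSlot_eq_mod hi, Nat.mod_add_mod, Nat.add_assoc, Nat.add_comm 1 j]
        refine List.mem_cons_of_mem _ (ih (nextSlot T.size i)
          (by rw [nextSlot_eq_mod hi]; exact Nat.mod_lt _ (by omega)) d (by omega) ?_ ?_)
        · rw [key]; exact he
        · intro d' hd'; rw [key]; exact hf _ (by omega)

theorem exists_slot_of_mem_run (T : Table E) (k i : ℕ) (hi : i < T.size) (e : E)
    (he : e ∈ T.run k i) : ∃ j < T.size, T.slot j = some e := by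
  induction k generalizing i with
  | zero => simp [run] at he
  | succ k ih =>
    unfold run at he
    split at he
    · simp at he
    · rename_i e' he'
      rcases List.mem_cons.1 he with rfl | h
      · exact ⟨i, hi, he'⟩
      · exact ih _ (by rw [nextSlot_eq_mod hi]; exact Nat.mod_lt _ (by omega)) h

/-- Probing writes the element into the slot that ends the run, at the cost of scanning it. -/
theorem probe_spec (wc : E → ℕ) (T : Table E) (e : E) (k i : ℕ) (hi : i < T.size)
    (hk : (T.run k i).length < k) :
    (T.probe wc e k i).val =
      { T with slot := Function.update T.slot ((i + (T.run k i).length) % T.size) (some e) } ∧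
    (T.probe wc e k i).time = (T.run k i).length + 1 + wc e := by
  induction k generalizing i with
  | zero => simp at hk
  | succ k ih =>
    unfold run at hk ⊢
    unfold probe
    cases h : T.slot i with
    | none =>
      simp [Nat.mod_eq_of_lt hi]
    | some e' =>
      simp only [h] at hk
      obtain ⟨h1, h2⟩ := ih (nextSlot T.size i)
        (by rw [nextSlot_eq_mod hi]; exact Nat.mod_lt _ (by omega)) (by simpa using hk)
      simp only [Timed.val_bind, Timed.time_bind, Timed.time_tick, h1, h2, List.length_cons]
      refine ⟨?_, by omega⟩
      generalize (T.run k (nextSlot T.size i)).length = n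
      rw [nextSlot_eq_mod hi, Nat.mod_add_mod, Nat.add_assoc, Nat.add_comm 1]

/-- `T` is a linear probing table holding the elements of `L`, which are listed with their hash
values: each element is stored once, and all slots from the one given by its hash value up to the
one holding it are full. The function `src` adds to the contents of the slots the hash values,
which the table itself does not keep. -/
def Holds (T : Table E) (L : List (E × ℕ)) : Prop :=
  ∃ src : ℕ → Option (E × ℕ), (∀ i, T.slot i = (src i).map Prod.fst) ∧
    ((List.range T.size).filterMap src).Perm L ∧
    ∀ i < T.size, ∀ e p, src i = some (e, p) →
      ∃ d < T.size, i = (p + d) % T.size ∧ ∀ d' ≤ d, T.slot ((p + d') % T.size) ≠ none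

theorem holds_empty (E : Type) (t : ℕ) : (Table.empty E t).Holds [] := by
  refine ⟨fun _ => none, by simp [Table.empty], by simp, by simp⟩

/-- Filling an empty slot adds its new content to the contents of the slots. -/
theorem filterMap_update_perm {B : Type} (l : List ℕ) (hl : l.Nodup) (f : ℕ → Option B) (i : ℕ)
    (hi : i ∈ l) (hf : f i = none) (b : B) :
    (l.filterMap (Function.update f i (some b))).Perm (b :: l.filterMap f) := by
  induction l with
  | nil => simp at hi
  | cons a l ih =>
    rw [List.nodup_cons] at hl
    by_cases ha : a = i
    · subst ha
      rw [List.filterMap_cons_some (by simp : Function.update f a (some b) a = some b),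
        List.filterMap_cons_none hf]
      rw [List.filterMap_congr (g := f)]
      intro x hx
      rw [Function.update_of_ne]
      rintro rfl; exact hl.1 hx
    · have hi' : i ∈ l := by simpa [Ne.symm ha] using hi
      have := ih hl.2 hi'
      cases hfa : f a with
      | none => rw [List.filterMap_cons_none hfa,
                  List.filterMap_cons_none (by rw [Function.update_of_ne ha, hfa])]
                exact this
      | some c =>
        rw [List.filterMap_cons_some hfa,
          List.filterMap_cons_some (by rw [Function.update_of_ne ha, hfa])]
        exact (this.cons c).trans (List.Perm.swap _ _ _)

/-- Counting elements amounts to counting slots, as every element is in exactly one slot. -/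
theorem Holds.countP_eq {T : Table E} {L : List (E × ℕ)} {src : ℕ → Option (E × ℕ)}
    (hp : ((List.range T.size).filterMap src).Perm L) (q : E × ℕ → Bool) :
    L.countP q = ((Finset.range T.size).filter fun i => ∃ x, src i = some x ∧ q x).card := by
  rw [← hp.countP_eq, List.countP_filterMap, List.countP_eq_length_filter]
  rw [← List.toFinset_card_of_nodup (List.nodup_range.filter _)]
  congr 1
  ext i
  simp only [List.mem_toFinset, List.mem_filter, List.mem_range, Finset.mem_filter,
    Finset.mem_range]
  cases src i <;> simp

/-- A table with fewer elements than slots has an empty slot. -/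
theorem Holds.exists_empty {T : Table E} {L : List (E × ℕ)} (h : T.Holds L)
    (hL : L.length < T.size) : ∃ i < T.size, T.slot i = none := by
  obtain ⟨src, h1, h2, -⟩ := h
  by_contra! hc
  have := Holds.countP_eq h2 (fun _ => true)
  rw [List.countP_true, Finset.filter_true_of_mem, Finset.card_range] at this
  · omega
  · intro i hi
    have := hc i (Finset.mem_range.1 hi)
    rw [h1] at this
    cases hs : src i with
    | none => simp [hs] at this
    | some x => exact ⟨x, rfl, rfl⟩

theorem Holds.run_length_lt {T : Table E} {L : List (E × ℕ)} (h : T.Holds L)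
    (hL : L.length < T.size) (i : ℕ) (hi : i < T.size) :
    (T.run T.size i).length < T.size := by
  obtain ⟨e, he, hs⟩ := h.exists_empty hL
  by_contra hc
  have hlen : (T.run T.size i).length = T.size := le_antisymm (run_length_le _ _ _) (by omega)
  refine slot_ne_none_of_lt_run_length T T.size i hi ((e + (T.size - i)) % T.size) ?_ ?_
  · rw [hlen]; exact Nat.mod_lt _ (by omega)
  · rw [Nat.add_mod_mod, show i + (e + (T.size - i)) = e + T.size by omega, Nat.add_mod_right,
      Nat.mod_eq_of_lt he, hs]

/-- An element of the table is met when scanning from its hash value. -/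
theorem Holds.mem_run_of_mem {T : Table E} {L : List (E × ℕ)} (h : T.Holds L) {e : E} {p : ℕ}
    (he : (e, p) ∈ L) : e ∈ T.run T.size (p % T.size) := by
  obtain ⟨src, h1, h2, h3⟩ := h
  rw [← h2.mem_iff, List.mem_filterMap] at he
  obtain ⟨i, hi, hs⟩ := he
  rw [List.mem_range] at hi
  obtain ⟨d, hd, rfl, hf⟩ := h3 i hi e p hs
  refine mem_run T _ _ (Nat.mod_lt _ (by omega)) d hd e ?_ ?_
  · rw [Nat.mod_add_mod, h1, hs]; rfl
  · intro d' hd'; rw [Nat.mod_add_mod]; exact hf d' hd'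

/-- The content of a slot is one of the elements of the table. -/
theorem Holds.exists_mem_of_slot {T : Table E} {L : List (E × ℕ)} (h : T.Holds L) {e : E}
    {i : ℕ} (hi : i < T.size) (he : T.slot i = some e) : ∃ p, (e, p) ∈ L := by
  obtain ⟨src, h1, h2, -⟩ := h
  rw [h1, Option.map_eq_some_iff] at he
  obtain ⟨⟨e', p⟩, hs, rfl⟩ := he
  exact ⟨p, h2.mem_iff.1 (List.mem_filterMap.2 ⟨i, List.mem_range.2 hi, hs⟩)⟩

/-- Insertion preserves the invariant, at the cost of scanning the run of the hash value. -/
theorem insert_spec (wc : E → ℕ) {T : Table E} {L : List (E × ℕ)} (h : T.Holds L)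
    (hL : L.length < T.size) (e : E) (hv : ℕ) :
    (T.insert wc e hv).val.Holds (L ++ [(e, hv)]) ∧
    (T.insert wc e hv).val.size = T.size ∧
    (T.insert wc e hv).time = (T.run T.size (hv % T.size)).length + 2 + wc e := by
  have ht : 0 < T.size := by omega
  have hi := Nat.mod_lt hv ht
  have hlt := h.run_length_lt hL _ hi
  obtain ⟨p1, p2⟩ := probe_spec wc T e T.size _ hi hlt
  have hnone := slot_run_length T T.size _ hi hlt
  have hfull := slot_ne_none_of_lt_run_length T T.size (hv % T.size) hi
  simp only [Table.insert, Timed.val_bind, Timed.time_bind, Timed.time_tick, p1, p2, true_and]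
  refine ⟨?_, by omega⟩
  generalize (T.run T.size (hv % T.size)).length = d at *
  simp only [Nat.mod_add_mod] at *
  obtain ⟨src, h1, h2, h3⟩ := h
  have hsrc : src ((hv + d) % T.size) = none := by
    have := h1 ((hv + d) % T.size)
    rw [hnone] at this
    exact (Option.map_eq_none_iff.1 this.symm)
  -- a full slot stays full
  have hmono : ∀ j, T.slot j ≠ none →
      Function.update T.slot ((hv + d) % T.size) (some e) j ≠ none := by
    intro j hj
    by_cases hjd : j = (hv + d) % T.size
    · simp [hjd]
    · rwa [Function.update_of_ne hjd]
  refine ⟨Function.update src ((hv + d) % T.size) (some (e, hv)), ?_, ?_, ?_⟩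
  · intro i
    by_cases hid : i = (hv + d) % T.size
    · subst hid; simp
    · simp [Function.update_of_ne hid, h1]
  · refine (filterMap_update_perm _ List.nodup_range _ _
      (List.mem_range.2 (Nat.mod_lt _ ht)) hsrc _).trans ?_
    exact ((h2.cons _).trans (List.perm_append_singleton _ _).symm)
  · intro i hiT e' p hs
    dsimp only at hiT ⊢
    by_cases hid : i = (hv + d) % T.size
    · subst hid
      simp only [Function.update_self, Option.some.injEq, Prod.mk.injEq] at hs
      obtain ⟨rfl, rfl⟩ := hs
      refine ⟨d, hlt, rfl, ?_⟩
      intro d' hd'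
      rcases hd'.lt_or_eq with hlt' | rfl
      · exact hmono _ (hfull _ hlt')
      · simp
    · rw [Function.update_of_ne hid] at hs
      obtain ⟨d', hd', hi', hf⟩ := h3 i hiT e' p hs
      exact ⟨d', hd', hi', fun j hj => hmono _ (hf j hj)⟩

/-- Insert elements, given with their hash values, one after the other. -/
def insertAll (wc : E → ℕ) (T : Table E) (L : List (E × ℕ)) : Table E :=
  L.foldl (fun T eh => (T.insert wc eh.1 eh.2).val) T

theorem insertAll_append_singleton (wc : E → ℕ) (T : Table E) (L : List (E × ℕ)) (e : E)
    (p : ℕ) :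
    T.insertAll wc (L ++ [(e, p)]) = ((T.insertAll wc L).insert wc e p).val := by
  simp [insertAll]

theorem holds_insertAll (wc : E → ℕ) (t : ℕ) (L : List (E × ℕ)) (hL : L = [] ∨ L.length < t) :
    ((Table.empty E t).insertAll wc L).Holds L ∧
      ((Table.empty E t).insertAll wc L).size = t := by
  induction L using List.reverseRecOn with
  | nil => exact ⟨holds_empty _ _, rfl⟩
  | append_singleton L a ih =>
    have hlt : L.length < t := by
      rcases hL with h | h
      · simp at h
      · simp at h; omega
    obtain ⟨i1, i2⟩ := ih (Or.inr hlt)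
    obtain ⟨e, p⟩ := a
    obtain ⟨s1, s2, -⟩ := insert_spec wc i1 (by omega) e p
    rw [insertAll_append_singleton]
    exact ⟨s1, s2.trans i2⟩

/-! ### Counting hash values in an arc bounds the length of a run -/

/-- The hash value `p` belongs, modulo `t`, to the arc of `s` slots that starts `d` slots before
slot `q`. -/
def InArc (t q d s p : ℕ) : Prop := ∃ j < s, (p + d) % t = (q + j) % t

instance (t q d s p : ℕ) : Decidable (InArc t q d s p) := by unfold InArc; infer_instance

/-- The number of pairs `(d, l)` such that the arc from `d` slots before to `l` slots after slot
`q` receives at least as many of the hash values `homes` as it has slots. -/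
def runBound (t : ℕ) (homes : List ℕ) (q : ℕ) : ℕ :=
  ∑ d ∈ Finset.range t, ∑ l ∈ Finset.range t,
    if d + l + 1 ≤ homes.countP (fun p => InArc t q d (d + l + 1) p) then 1 else 0

theorem runBound_mono {t : ℕ} {H H' : List ℕ} (h : H.Sublist H') (q : ℕ) :
    runBound t H q ≤ runBound t H' q := by
  unfold runBound
  refine Finset.sum_le_sum fun d _ => Finset.sum_le_sum fun l _ => ?_
  have := h.countP_le (p := fun p => InArc t q d (d + l + 1) p)
  split_ifs <;> omega

/-- If the slots of an arc are full and the slot before the arc is empty, then the elements in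
the slots of the arc have their hash values in the arc. -/
theorem Holds.le_countP_inArc {T : Table E} {L : List (E × ℕ)} (h : T.Holds L) {q d s : ℕ}
    (hd : d < T.size) (hs : s < T.size)
    (hfull : ∀ j < s, T.slot ((q + (T.size - d) + j) % T.size) ≠ none)
    (hempty : T.slot ((q + (T.size - d) + (T.size - 1)) % T.size) = none) :
    s ≤ (L.map Prod.snd).countP (fun p => InArc T.size q d s p) := by
  obtain ⟨src, h1, h2, h3⟩ := h
  rw [List.countP_map, Holds.countP_eq h2]
  set t := T.size with ht
  set a := q + (t - d) with ha
  have hinj : Set.InjOn (fun j => (a + j) % t) (Finset.range s : Set ℕ) := by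
    intro j hj k hk hjk
    simp only [Finset.coe_range, Set.mem_Iio] at hj hk
    have : j % t = k % t := Nat.ModEq.add_left_cancel' a hjk
    rwa [Nat.mod_eq_of_lt (by omega), Nat.mod_eq_of_lt (by omega)] at this
  refine (Finset.card_range s).symm.le.trans ((Finset.card_image_of_injOn hinj).symm.le.trans
    (Finset.card_le_card fun i hi => ?_))
  obtain ⟨j, hj, rfl⟩ := Finset.mem_image.1 hi
  rw [Finset.mem_range] at hj
  have hit : (a + j) % t < t := Nat.mod_lt _ (by omega)
  rw [Finset.mem_filter, Finset.mem_range]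
  refine ⟨hit, ?_⟩
  have hne := hfull j hj
  rw [h1] at hne
  cases hsrc : src ((a + j) % t) with
  | none => simp [hsrc] at hne
  | some x =>
    obtain ⟨e, p⟩ := x
    refine ⟨(e, p), rfl, ?_⟩
    obtain ⟨d', hd', hi', hf⟩ := h3 _ hit e p hsrc
    simp only [Function.comp, decide_eq_true_eq]
    -- otherwise the path from the hash value to the slot passes the empty slot
    have hle : d' ≤ j := by
      by_contra hlt
      push Not at hlt
      refine hf (d' - j - 1) (by omega) ?_
      rw [← hempty]
      congr 1
      refine Nat.ModEq.add_right_cancel' (j + 1) ?_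
      rw [show p + (d' - j - 1) + (j + 1) = p + d' by omega]
      refine Nat.ModEq.trans (b := a + j) hi'.symm ?_
      rw [show a + (t - 1) + (j + 1) = a + j + t by omega]
      exact (Nat.add_mod_right _ _).symm
    refine ⟨j - d', by omega, ?_⟩
    refine Nat.ModEq.add_right_cancel' d' ?_
    rw [show q + (j - d') + d' = q + j by omega, show p + d + d' = (p + d') + d by omega]
    refine (Nat.ModEq.add_right d (show (p + d') % t = (a + j) % t from hi'.symm)).trans ?_
    rw [show a + j + d = q + j + t by omega]
    exact Nat.add_mod_right _ _

/-- The key deterministic bound: a run is at most as long as the number of arcs around its start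
that are overfull. -/
theorem Holds.run_length_le_runBound {T : Table E} {L : List (E × ℕ)} (h : T.Holds L)
    (hL : L.length < T.size) (q : ℕ) :
    (T.run T.size (q % T.size)).length ≤ runBound T.size (L.map Prod.snd) q := by
  have ht : 0 < T.size := by omega
  have hi := Nat.mod_lt q ht
  have hlt := h.run_length_lt hL _ hi
  have hnone := slot_run_length T T.size _ hi hlt
  have hfull := slot_ne_none_of_lt_run_length T T.size (q % T.size) hi
  generalize (T.run T.size (q % T.size)).length = n at *
  simp only [Nat.mod_add_mod] at *
  -- the distance from `q` back to the slot after the first empty one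
  have hex : ∃ d, T.slot ((q + (T.size - d) + (T.size - 1)) % T.size) = none ∧ d < T.size := by
    refine ⟨T.size - 1 - n, ?_, by omega⟩
    rw [← hnone, show q + (T.size - (T.size - 1 - n)) + (T.size - 1) = q + n + T.size by omega,
      Nat.add_mod_right]
  classical
  obtain ⟨hd1, hd2⟩ := Nat.find_spec hex
  have hmin := fun m => Nat.find_min hex (m := m)
  generalize Nat.find hex = d at *
  have hback : ∀ m < d, T.slot ((q + (T.size - m) + (T.size - 1)) % T.size) ≠ none :=
    fun m hm hc => hmin m hm ⟨hc, by omega⟩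
  have hdn : d + n < T.size := by
    by_contra hc
    refine hfull (T.size - 1 - d) (by omega) ?_
    rw [← hd1]
    congr 1
    rw [show q + (T.size - d) + (T.size - 1) = q + (T.size - 1 - d) + T.size by omega,
      Nat.add_mod_right]
  unfold runBound
  calc n = ∑ l ∈ Finset.range n, 1 := by simp
    _ ≤ ∑ l ∈ Finset.range n,
        if d + l + 1 ≤ (L.map Prod.snd).countP (fun p => InArc T.size q d (d + l + 1) p)
          then 1 else 0 := by
      refine Finset.sum_le_sum fun l hl => ?_
      rw [Finset.mem_range] at hl
      rw [if_pos]
      refine h.le_countP_inArc hd2 (by omega) (fun j hj => ?_) hd1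
      rcases lt_or_ge j d with hjd | hjd
      · have := hback (d - 1 - j) (by omega)
        rw [show q + (T.size - (d - 1 - j)) + (T.size - 1) = q + (T.size - d) + j + T.size by
          omega, Nat.add_mod_right] at this
        exact this
      · have := hfull (j - d) (by omega)
        rw [show q + (T.size - d) + j = q + (j - d) + T.size by omega, Nat.add_mod_right]
        exact this
    _ ≤ ∑ l ∈ Finset.range T.size,
        if d + l + 1 ≤ (L.map Prod.snd).countP (fun p => InArc T.size q d (d + l + 1) p)
          then 1 else 0 :=
      Finset.sum_le_sum_of_subset (Finset.range_mono (by omega))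
    _ ≤ _ := Finset.single_le_sum (f := fun d => ∑ l ∈ Finset.range T.size,
        if d + l + 1 ≤ (L.map Prod.snd).countP (fun p => InArc T.size q d (d + l + 1) p)
          then 1 else 0) (fun _ _ => Nat.zero_le _) (Finset.mem_range.2 hd2)

end Table

/-! ### Fully random hashing: the expected length of a run -/

namespace FullyRandom

variable {U Ω : Type*} [MeasurableSpace Ω] {P : Measure Ω} {R : U → ℕ} {h : U → Ω → ℕ}

/-- A function of finitely many hash values is measurable. -/
theorem measurable_comp (hh : FullyRandom P R h) {B : Type*} [MeasurableSpace B] {S : Finset U}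
    {F : (U → ℕ) → B} (hF : DependsOn F (S : Set U)) : Measurable fun ω => F fun u => h u ω := by
  classical
  let F' : (S → ℕ) → B := fun g => F fun u => if hu : u ∈ S then g ⟨u, hu⟩ else 0
  have : (fun ω => F fun u => h u ω) = F' ∘ fun ω (u : S) => h u ω := by
    funext ω
    refine hF fun u hu => ?_
    simp [Finset.mem_coe.1 hu]
  rw [this]
  exact Measurable.of_discrete.comp (measurable_pi_lambda _ fun u => hh.1 u)

/-- Functions of the hash values of disjoint finite sets of keys are independent. -/
theorem lintegral_mul (hh : FullyRandom P R h) {S T : Finset U} (hST : Disjoint S T)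
    {F G : (U → ℕ) → ℝ≥0∞} (hF : DependsOn F (S : Set U)) (hG : DependsOn G (T : Set U)) :
    ∫⁻ ω, F (fun u => h u ω) * G (fun u => h u ω) ∂P =
      (∫⁻ ω, F (fun u => h u ω) ∂P) * ∫⁻ ω, G (fun u => h u ω) ∂P := by
  classical
  let F' : (S → ℕ) → ℝ≥0∞ := fun g => F fun u => if hu : u ∈ S then g ⟨u, hu⟩ else 0
  let G' : (T → ℕ) → ℝ≥0∞ := fun g => G fun u => if hu : u ∈ T then g ⟨u, hu⟩ else 0
  have e1 : (fun ω => F fun u => h u ω) = F' ∘ fun ω (u : S) => h u ω := by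
    funext ω
    refine hF fun u hu => ?_
    simp [Finset.mem_coe.1 hu]
  have e2 : (fun ω => G fun u => h u ω) = G' ∘ fun ω (u : T) => h u ω := by
    funext ω
    refine hG fun u hu => ?_
    simp [Finset.mem_coe.1 hu]
  refine lintegral_mul_eq_lintegral_mul_lintegral_of_indepFun (hh.measurable_comp hF)
    (hh.measurable_comp hG) ?_
  rw [e1, e2]
  exact (hh.2.2.indepFun_finset S T hST hh.1).comp (φ := F') (ψ := G') Measurable.of_discrete
    Measurable.of_discrete

variable [IsProbabilityMeasure P]

theorem measure_ge (hh : FullyRandom P R h) (u : U) : P {ω | R u ≤ h u ω} = 0 := by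
  obtain ⟨hR, hu⟩ := hh.2.1 u
  have hc : {ω | R u ≤ h u ω} = (⋃ v ∈ Finset.range (R u), h u ⁻¹' {v})ᶜ := by
    ext ω
    simp only [Set.mem_ofPred_eq, Set.mem_compl_iff, Set.mem_iUnion, Finset.mem_range,
      Set.mem_preimage, Set.mem_singleton_iff, exists_prop, exists_eq_right', not_lt]
  have hm : MeasurableSet (⋃ v ∈ Finset.range (R u), h u ⁻¹' {v}) :=
    Finset.measurableSet_biUnion _ fun v _ => hh.1 u (MeasurableSet.singleton v)
  have h1 : P (⋃ v ∈ Finset.range (R u), h u ⁻¹' {v}) = 1 := by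
    rw [measure_biUnion_finset]
    · rw [Finset.sum_congr rfl fun v hv => hu v (Finset.mem_range.1 hv)]
      rw [Finset.sum_const, Finset.card_range, nsmul_eq_mul,
        ENNReal.mul_inv_cancel (by exact_mod_cast hR.ne') (by simp)]
    · intro v _ v' _ hvv
      rw [Function.onFun, Set.disjoint_left]
      intro ω h1 h2
      exact hvv (h1.symm.trans h2)
    · exact fun v _ => hh.1 u (MeasurableSet.singleton v)
  rw [hc, prob_compl_eq_zero_iff hm, h1]

/-- The hash value modulo a divisor `t` of its range is uniform. -/
theorem measure_mod_le (hh : FullyRandom P R h) (u : U) {t : ℕ} (ht : t ∣ R u) (v : ℕ) :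
    P {ω | h u ω % t = v % t} ≤ (t : ℝ≥0∞)⁻¹ := by
  obtain ⟨k, hk⟩ := ht
  obtain ⟨hR, hu⟩ := hh.2.1 u
  have ht : 0 < t := Nat.pos_of_ne_zero (by rintro rfl; simp [hk] at hR)
  have hk0 : 0 < k := Nat.pos_of_ne_zero (by rintro rfl; simp [hk] at hR)
  have hv := Nat.mod_lt v ht
  have hsub : {ω | h u ω % t = v % t} ⊆
      {ω | R u ≤ h u ω} ∪ ⋃ j ∈ Finset.range k, h u ⁻¹' {t * j + v % t} := by
    intro ω hω
    rcases le_or_gt (R u) (h u ω) with hle | hlt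
    · exact Or.inl hle
    · refine Or.inr (Set.mem_biUnion (x := h u ω / t) ?_ ?_)
      · rw [hk] at hlt
        simpa using Nat.div_lt_of_lt_mul hlt
      · simp only [Set.mem_preimage, Set.mem_singleton_iff]
        conv_lhs => rw [← Nat.div_add_mod (h u ω) t]
        rw [show h u ω % t = v % t from hω]
  calc P {ω | h u ω % t = v % t} ≤ 0 + ∑ j ∈ Finset.range k, (R u : ℝ≥0∞)⁻¹ := by
        refine (measure_mono hsub).trans ((measure_union_le _ _).trans ?_)
        rw [hh.measure_ge u]
        gcongr
        refine (measure_biUnion_finset_le _ _).trans (Finset.sum_le_sum fun j hj => ?_)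
        refine (hu _ ?_).le
        have : j + 1 ≤ k := Finset.mem_range.1 hj
        rw [hk]
        nlinarith
    _ = (t : ℝ≥0∞)⁻¹ := by
        rw [zero_add, Finset.sum_const, Finset.card_range, nsmul_eq_mul, hk, Nat.cast_mul,
          ENNReal.mul_inv (Or.inr (by simp)) (Or.inl (by simp)), mul_comm, mul_assoc,
          ENNReal.inv_mul_cancel (by exact_mod_cast hk0.ne') (by simp), mul_one]

/-- The probability that a hash value belongs to an arc of `s` slots. -/
theorem measure_inArc_le (hh : FullyRandom P R h) (u : U) {t : ℕ} (ht : t ∣ R u)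
    (q d s : ℕ) : P {ω | Table.InArc t q d s (h u ω)} ≤ s * (t : ℝ≥0∞)⁻¹ := by
  have ht0 : 0 < t := Nat.pos_of_ne_zero (by
    rintro rfl; have := (hh.2.1 u).1; rw [zero_dvd_iff] at ht; omega)
  have hsub : {ω | Table.InArc t q d s (h u ω)} ⊆
      ⋃ j ∈ Finset.range s, {ω | h u ω % t = (q + j + (t - 1) * d) % t} := by
    rintro ω ⟨j, hj, hω⟩
    refine Set.mem_biUnion (x := j) (by simpa using hj) ?_
    show h u ω ≡ q + j + (t - 1) * d [MOD t]
    refine Nat.ModEq.add_right_cancel' d (Nat.ModEq.trans hω ?_)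
    have : q + j + (t - 1) * d + d = q + j + t * d := by
      obtain ⟨t, rfl⟩ := Nat.exists_eq_succ_of_ne_zero ht0.ne'
      simp; ring
    rw [this]
    exact (Nat.add_mul_mod_self_left _ _ _).symm
  refine (measure_mono hsub).trans ((measure_biUnion_finset_le _ _).trans ?_)
  refine (Finset.sum_le_sum fun j _ => hh.measure_mod_le u ht _).trans ?_
  simp

/-- One factor of the exponential moment of the number of hash values in an arc. -/
theorem lintegral_weight_le (hh : FullyRandom P R h) (u : U) {t : ℕ} (ht : t ∣ R u)
    (q d s : ℕ) {z : ℝ} (hz : 1 ≤ z) :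
    ∫⁻ ω, (if Table.InArc t q d s (h u ω) then ENNReal.ofReal z else 1) ∂P ≤
      ENNReal.ofReal (Real.exp ((z - 1) * (s / t))) := by
  have ht0 : 0 < t := Nat.pos_of_ne_zero (by
    rintro rfl; have := (hh.2.1 u).1; rw [zero_dvd_iff] at ht; omega)
  have hm : MeasurableSet {ω | Table.InArc t q d s (h u ω)} :=
    hh.1 u (Set.to_countable {p | Table.InArc t q d s p}).measurableSet
  have e : ∀ ω, (if Table.InArc t q d s (h u ω) then ENNReal.ofReal z else 1) =
      1 + {ω | Table.InArc t q d s (h u ω)}.indicator (fun _ => ENNReal.ofReal (z - 1)) ω := by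
    intro ω
    by_cases hω : Table.InArc t q d s (h u ω)
    · rw [if_pos hω, Set.indicator_of_mem (show ω ∈ {ω | Table.InArc t q d s (h u ω)} from hω),
        ← ENNReal.ofReal_one, ← ENNReal.ofReal_add zero_le_one (by linarith)]
      congr 1; ring
    · rw [if_neg hω,
        Set.indicator_of_notMem (show ω ∉ {ω | Table.InArc t q d s (h u ω)} from hω), add_zero]
  simp_rw [e]
  rw [lintegral_add_left measurable_const, lintegral_const, measure_univ, one_mul,
    lintegral_indicator_const hm]
  calc 1 + ENNReal.ofReal (z - 1) * P {ω | Table.InArc t q d s (h u ω)}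
      ≤ 1 + ENNReal.ofReal (z - 1) * (s * (t : ℝ≥0∞)⁻¹) := by
        gcongr; exact hh.measure_inArc_le u ht q d s
    _ = ENNReal.ofReal (1 + (z - 1) * (s / t)) := by
        rw [ENNReal.ofReal_add zero_le_one (mul_nonneg (by linarith) (by positivity)),
          ENNReal.ofReal_one, ENNReal.ofReal_mul (by linarith),
          ENNReal.ofReal_div_of_pos (by exact_mod_cast ht0), ENNReal.ofReal_natCast,
          ENNReal.ofReal_natCast, div_eq_mul_inv]
    _ ≤ _ := by
        refine ENNReal.ofReal_le_ofReal ?_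
        have := Real.add_one_le_exp ((z - 1) * (s / t : ℝ))
        linarith

/-- The exponential moment of the number of hash values in an arc. -/
theorem lintegral_prod_weight_le (hh : FullyRandom P R h) (K : Finset U) {t : ℕ}
    (ht : ∀ u ∈ K, t ∣ R u) (q d s : ℕ) {z : ℝ} (hz : 1 ≤ z) :
    ∫⁻ ω, ∏ u ∈ K, (if Table.InArc t q d s (h u ω) then ENNReal.ofReal z else 1) ∂P ≤
      ENNReal.ofReal (Real.exp ((z - 1) * (s / t)) ^ K.card) := by
  classical
  induction K using Finset.induction_on with
  | empty => simp
  | insert u K hu ih =>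
    have hdisj : Disjoint {u} K := by simpa using hu
    have := hh.lintegral_mul hdisj
      (F := fun g => if Table.InArc t q d s (g u) then ENNReal.ofReal z else 1)
      (G := fun g => ∏ u ∈ K, (if Table.InArc t q d s (g u) then ENNReal.ofReal z else 1))
      (fun g g' hg => by simp [hg u (by simp)])
      (fun g g' hg => Finset.prod_congr rfl fun v hv => by rw [hg v hv])
    simp_rw [Finset.prod_insert hu]
    rw [this, Finset.card_insert_of_notMem hu, pow_succ', ENNReal.ofReal_mul (by positivity)]
    exact mul_le_mul' (hh.lintegral_weight_le u (ht u (by simp)) q d s hz)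
      (ih fun v hv => ht v (by simp [hv]))

/-- Chernoff's bound for an arc around the hash value of the key `k`. The event that the arc of
`s` slots receives at least `s` hash values is estimated by `α ^ s * (1 / α) ^ X`, where `X` is
the number of hash values in the arc. The key `k` itself accounts for the factor `1 / α`, the
others are independent of the place of the arc. -/
theorem lintegral_overfull_le (hh : FullyRandom P R h) {α : ℝ} (hα₀ : 0 < α) (hα₁ : α < 1)
    {t : ℕ} (ks : List U) (hks : ks.Nodup) (k : U) (ht : ∀ u ∈ ks, t ∣ R u) (htk : t ∣ R k)
    (hlen : (ks.length : ℝ) ≤ α * t) (d s : ℕ) :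
    ∫⁻ ω, (if s ≤ (ks.map fun u => h u ω).countP (fun p => Table.InArc t (h k ω) d s p)
      then 1 else 0) ∂P ≤ ENNReal.ofReal (1 / α * (α * Real.exp (1 - α)) ^ s) := by
  classical
  have ht0 : 0 < t := Nat.pos_of_ne_zero (by
    rintro rfl; have := (hh.2.1 k).1; rw [zero_dvd_iff] at htk; omega)
  have hz : 1 ≤ 1 / α := by rw [le_div_iff₀ hα₀]; linarith
  set K : Finset U := ks.toFinset.erase k with hK
  set W : ℕ → U → (U → ℕ) → ℝ≥0∞ := fun q u g =>
    if Table.InArc t q d s (g u) then ENNReal.ofReal (1 / α) else 1 with hW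
  -- the exponential estimate for a fixed place of the arc
  have hpt : ∀ (g : U → ℕ) (q : ℕ),
      (if s ≤ (ks.map g).countP (fun p => Table.InArc t q d s p) then (1 : ℝ≥0∞) else 0) ≤
        ENNReal.ofReal (1 / α * α ^ s) * ∏ u ∈ K, W q u g := by
    intro g q
    split_ifs with hs
    swap
    · exact zero_le
    have hcard : s ≤ (K.filter fun u => Table.InArc t q d s (g u)).card + 1 := by
      rw [List.countP_map, List.countP_eq_length_filter,
        ← List.toFinset_card_of_nodup (hks.filter _)] at hs
      refine hs.trans ((Finset.card_le_card ?_).trans (Finset.card_insert_le k _))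
      intro u hu
      simp only [List.mem_toFinset, List.mem_filter, Function.comp, decide_eq_true_eq] at hu
      by_cases huk : u = k
      · simp [huk]
      · simp [hK, huk, hu.1, hu.2]
    have hprod : ∏ u ∈ K, W q u g =
        ENNReal.ofReal (1 / α) ^ (K.filter fun u => Table.InArc t q d s (g u)).card := by
      simp only [hW, Finset.prod_ite, Finset.prod_const, one_pow, mul_one]
    rw [hprod, ← ENNReal.ofReal_pow (by positivity), ← ENNReal.ofReal_mul (by positivity),
      ENNReal.one_le_ofReal]
    calc (1 : ℝ) = 1 / α * α ^ s * (1 / α) ^ s * α := by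
          rw [one_div_pow]; field_simp
      _ ≤ 1 / α * α ^ s * (1 / α) ^ ((K.filter fun u => Table.InArc t q d s (g u)).card + 1) *
            α := by gcongr
      _ = _ := by
          rw [pow_succ]; field_simp
  -- the place of the arc depends on the hash value modulo `t` only
  have hsplit : ∀ ω,
      (if s ≤ (ks.map fun u => h u ω).countP (fun p => Table.InArc t (h k ω) d s p)
        then (1 : ℝ≥0∞) else 0) ≤
      ∑ v ∈ Finset.range t, ENNReal.ofReal (1 / α * α ^ s) *
        ((if h k ω % t = v % t then 1 else 0) * ∏ u ∈ K, W v u fun u => h u ω) := by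
    intro ω
    have hmod : ∀ p, Table.InArc t (h k ω) d s p ↔ Table.InArc t (h k ω % t) d s p := by
      intro p; simp [Table.InArc]
    simp_rw [hmod]
    refine (hpt _ _).trans (le_trans ?_ (Finset.single_le_sum (fun _ _ => zero_le)
      (Finset.mem_range.2 (Nat.mod_lt (h k ω) ht0))))
    simp
  have hdep : ∀ v, DependsOn (fun g : U → ℕ => ∏ u ∈ K, W v u g) (K : Set U) := fun v g g' hg =>
    Finset.prod_congr rfl fun u hu => by simp only [hW, hg u hu]
  have hdep' : ∀ v, DependsOn (fun g : U → ℕ => if g k % t = v % t then (1 : ℝ≥0∞) else 0)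
      (({k} : Finset U) : Set U) := fun v g g' hg => by simp [hg k (by simp)]
  have hdisj : Disjoint ({k} : Finset U) K := by simp [hK]
  refine (lintegral_mono hsplit).trans ?_
  have hmeas : ∀ v, Measurable fun ω => (if h k ω % t = v % t then (1 : ℝ≥0∞) else 0) *
      ∏ u ∈ K, W v u fun u => h u ω := fun v =>
    (hh.measurable_comp (hdep' v)).mul (hh.measurable_comp (hdep v))
  rw [lintegral_finsetSum _ fun v _ => (hmeas v).const_mul _]
  have hcardK : (K.card : ℝ) ≤ α * t := by
    refine le_trans ?_ hlen
    exact_mod_cast (Finset.card_le_card (Finset.erase_subset _ _)).trans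
      (List.toFinset_card_le ks)
  have hterm : ∀ v ∈ Finset.range t, ∫⁻ ω, ENNReal.ofReal (1 / α * α ^ s) *
      ((if h k ω % t = v % t then 1 else 0) * ∏ u ∈ K, W v u fun u => h u ω) ∂P ≤
      (t : ℝ≥0∞)⁻¹ * ENNReal.ofReal (1 / α * (α * Real.exp (1 - α)) ^ s) := by
    intro v _
    rw [lintegral_const_mul _ (hmeas v), hh.lintegral_mul hdisj (hdep' v) (hdep v)]
    have h1 : ∫⁻ ω, (if h k ω % t = v % t then (1 : ℝ≥0∞) else 0) ∂P ≤ (t : ℝ≥0∞)⁻¹ := by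
      have hm : MeasurableSet {ω | h k ω % t = v % t} :=
        hh.1 k (Set.to_countable {p | p % t = v % t}).measurableSet
      have : (fun ω => if h k ω % t = v % t then (1 : ℝ≥0∞) else 0) =
          {ω | h k ω % t = v % t}.indicator fun _ => 1 := by
        funext ω; simp [Set.indicator]
      rw [this, lintegral_indicator_const hm, one_mul]
      exact hh.measure_mod_le k htk v
    have h2 : ∫⁻ ω, ∏ u ∈ K, W v u (fun u => h u ω) ∂P ≤
        ENNReal.ofReal (Real.exp (1 - α) ^ s) := by
      refine (hh.lintegral_prod_weight_le K (fun u hu => ht u ?_) v d s hz).trans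
        (ENNReal.ofReal_le_ofReal ?_)
      · simpa using Finset.mem_of_mem_erase hu
      · rw [← Real.exp_nat_mul, ← Real.exp_nat_mul]
        refine Real.exp_le_exp.2 ?_
        have ht' : (0 : ℝ) < t := by exact_mod_cast ht0
        calc (K.card : ℝ) * ((1 / α - 1) * (s / t)) ≤ (α * t) * ((1 / α - 1) * (s / t)) := by
              gcongr
          _ = s * (1 - α) := by field_simp
    calc ENNReal.ofReal (1 / α * α ^ s) * ((∫⁻ ω, (if h k ω % t = v % t then 1 else 0) ∂P) *
            ∫⁻ ω, ∏ u ∈ K, W v u (fun u => h u ω) ∂P)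
        ≤ ENNReal.ofReal (1 / α * α ^ s) *
            ((t : ℝ≥0∞)⁻¹ * ENNReal.ofReal (Real.exp (1 - α) ^ s)) := by gcongr
      _ = _ := by
        rw [mul_left_comm, ← ENNReal.ofReal_mul (by positivity)]
        congr 2
        rw [mul_pow]; ring
  refine (Finset.sum_le_sum hterm).trans ?_
  rw [Finset.sum_const, Finset.card_range, nsmul_eq_mul, ← mul_assoc,
    ENNReal.mul_inv_cancel (by exact_mod_cast ht0.ne') (by simp), one_mul]

theorem load_exp_lt_one {α : ℝ} (hα₁ : α < 1) : α * Real.exp (1 - α) < 1 := by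
  have := Real.add_one_lt_exp (x := α - 1) (by linarith)
  have h2 := Real.exp_pos (1 - α)
  calc α * Real.exp (1 - α) < Real.exp (α - 1) * Real.exp (1 - α) := by
        gcongr; linarith
    _ = 1 := by rw [← Real.exp_add]; simp

/-- The expected length of a run depends on the load factor only. -/
theorem lintegral_runBound_le (hh : FullyRandom P R h) {α : ℝ} (hα₀ : 0 < α) (hα₁ : α < 1)
    {t : ℕ} (ks : List U) (hks : ks.Nodup) (k : U) (ht : ∀ u ∈ ks, t ∣ R u) (htk : t ∣ R k)
    (hlen : (ks.length : ℝ) ≤ α * t) :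
    ∫⁻ ω, (Table.runBound t (ks.map fun u => h u ω) (h k ω) : ℝ≥0∞) ∂P ≤
      ENNReal.ofReal (1 / α * (1 - α * Real.exp (1 - α))⁻¹ ^ 2) := by
  classical
  have hρ := load_exp_lt_one hα₁
  have hρ0 : 0 < α * Real.exp (1 - α) := by positivity
  set ρ := α * Real.exp (1 - α) with hρd
  have hdep : ∀ d s, DependsOn (fun g : U → ℕ =>
      if s ≤ (ks.map g).countP (fun p => Table.InArc t (g k) d s p) then (1 : ℝ≥0∞) else 0)
      ((insert k ks.toFinset : Finset U) : Set U) := by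
    intro d s g g' hg
    have h1 : ks.map g = ks.map g' :=
      List.map_congr_left fun u hu => hg u (by simp [hu])
    simp only [h1, hg k (by simp)]
  have hmeas : ∀ d s, Measurable fun ω =>
      if s ≤ (ks.map fun u => h u ω).countP (fun p => Table.InArc t (h k ω) d s p)
        then (1 : ℝ≥0∞) else 0 := fun d s => hh.measurable_comp (hdep d s)
  simp only [Table.runBound, Nat.cast_sum, Nat.cast_ite, Nat.cast_one, Nat.cast_zero]
  rw [lintegral_finsetSum _ fun d _ => Finset.measurable_sum _ fun l _ => hmeas d _]
  have hgeom : ∑ l ∈ Finset.range t, ρ ^ l ≤ (1 - ρ)⁻¹ := by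
    rw [← tsum_geometric_of_lt_one hρ0.le hρ]
    exact (summable_geometric_of_lt_one hρ0.le hρ).sum_le_tsum _ fun _ _ => by positivity
  calc ∑ d ∈ Finset.range t, ∫⁻ ω, ∑ l ∈ Finset.range t,
        (if d + l + 1 ≤ (ks.map fun u => h u ω).countP
          (fun p => Table.InArc t (h k ω) d (d + l + 1) p) then (1 : ℝ≥0∞) else 0) ∂P
      ≤ ∑ d ∈ Finset.range t, ∑ l ∈ Finset.range t,
          ENNReal.ofReal (1 / α * ρ ^ (d + l + 1)) := by
        refine Finset.sum_le_sum fun d _ => ?_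
        rw [lintegral_finsetSum _ fun l _ => hmeas d _]
        exact Finset.sum_le_sum fun l _ =>
          hh.lintegral_overfull_le hα₀ hα₁ ks hks k ht htk hlen d _
    _ = ENNReal.ofReal (∑ d ∈ Finset.range t, ∑ l ∈ Finset.range t,
          1 / α * ρ ^ (d + l + 1)) := by
        rw [ENNReal.ofReal_sum_of_nonneg fun _ _ => Finset.sum_nonneg fun _ _ => by positivity]
        exact Finset.sum_congr rfl fun d _ =>
          (ENNReal.ofReal_sum_of_nonneg fun _ _ => by positivity).symm
    _ ≤ _ := by
        refine ENNReal.ofReal_le_ofReal ?_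
        calc ∑ d ∈ Finset.range t, ∑ l ∈ Finset.range t, 1 / α * ρ ^ (d + l + 1)
            ≤ ∑ d ∈ Finset.range t, ∑ l ∈ Finset.range t, 1 / α * (ρ ^ d * ρ ^ l) := by
              refine Finset.sum_le_sum fun d _ => Finset.sum_le_sum fun l _ => ?_
              rw [← pow_add]
              gcongr 1 / α * ?_
              exact pow_le_pow_of_le_one hρ0.le hρ.le (by omega)
          _ = 1 / α * ((∑ d ∈ Finset.range t, ρ ^ d) * ∑ l ∈ Finset.range t, ρ ^ l) := by
              simp_rw [Finset.sum_mul_sum, Finset.mul_sum]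
          _ ≤ 1 / α * ((1 - ρ)⁻¹ * (1 - ρ)⁻¹) := by
              have : 0 ≤ ∑ l ∈ Finset.range t, ρ ^ l :=
                Finset.sum_nonneg fun _ _ => by positivity
              have h0 : 0 ≤ (1 - ρ)⁻¹ := by rw [inv_nonneg]; linarith
              gcongr
          _ = _ := by rw [sq]

end FullyRandom

/-! ### Compaction and rank queries -/

theorem popcount_add (bit : ℕ → Bool) (a m n : ℕ) :
    popcount bit a (m + n) = popcount bit a m + popcount bit (a + m) n := by
  unfold popcount
  rw [List.range_add, List.filter_append, List.length_append, List.filter_map, List.length_map]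
  congr 3
  funext j
  simp [Nat.add_assoc]

theorem popcount_congr {bit bit' : ℕ → Bool} {n : ℕ} (h : ∀ i < n, bit i = bit' i) :
    popcount bit 0 n = popcount bit' 0 n := by
  unfold popcount
  rw [List.filter_congr]
  intro j hj
  rw [List.mem_range] at hj
  simpa using h j hj

theorem popcount_zero_succ (bit : ℕ → Bool) (n : ℕ) :
    popcount bit 0 (n + 1) = popcount bit 0 n + (bit n).toNat := by
  rw [popcount_add]
  cases h : bit n <;> simp [popcount, List.range_succ, h]

theorem popcount_zero_mono (bit : ℕ → Bool) {m n : ℕ} (h : m ≤ n) :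
    popcount bit 0 m ≤ popcount bit 0 n := by
  obtain ⟨k, rfl⟩ := Nat.exists_eq_add_of_le h
  rw [popcount_add]
  omega

theorem eq_length_of_range_eq_append {n a : ℕ} {l₁ l₂ : List ℕ}
    (h : List.range n = l₁ ++ a :: l₂) : a = l₁.length ∧ l₁.length < n := by
  have hlen := congrArg List.length h
  simp only [List.length_range, List.length_append, List.length_cons] at hlen
  have h1 : (List.range n)[l₁.length]? = some a := by rw [h]; simp
  rw [List.getElem?_range (by omega)] at h1
  exact ⟨(Option.some.inj h1).symm, by omega⟩

/-- A rank query is correct if the sample at the start of the block of bit `i` is; it counts fewer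
than `δ` whole words. -/
theorem CTable.rank_spec {E : Type} {δ w : ℕ} (hδ : 0 < δ) (C : CTable E) (i : ℕ)
    (hs : C.sample (i / (δ * w)) = popcount C.bit 0 (i / (δ * w) * (δ * w))) :
    (C.rank δ w i).val = popcount C.bit 0 i ∧ (C.rank δ w i).time ≤ δ + 2 := by
  set b := i / (δ * w) with hb
  have hbd : b = i / w / δ := by rw [hb, Nat.div_div_eq_div_mul, Nat.mul_comm]
  have hle : b * δ ≤ i / w := by rw [hbd]; exact Nat.div_mul_le_self _ _
  have hlt : i / w - b * δ < δ := by
    have := Nat.div_add_mod (i / w) δ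
    have := Nat.mod_lt (i / w) hδ
    rw [hbd, Nat.mul_comm]; omega
  have key := Timed.foldlM_spec (S := ℕ)
    (fun s j => do
      tick 1
      pure (s + popcount C.bit ((b * δ + j) * w) w))
    (fun _ => 1) (fun l s => s = popcount C.bit 0 ((b * δ + l.length) * w))
    (List.range (i / w - b * δ))
    (by
      intro l₁ a l₂ s hl hI
      obtain ⟨rfl, -⟩ := eq_length_of_range_eq_append hl
      simp only [Timed.Spec, Timed.val_bind, Timed.time_bind, Timed.val_pure, Timed.time_pure,
        Timed.time_tick, List.length_append, List.length_singleton, hI]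
      refine ⟨?_, by omega⟩
      rw [show (b * δ + (l₁.length + 1)) * w = (b * δ + l₁.length) * w + w by ring,
        popcount_add, Nat.zero_add])
    (C.sample b)
    (by rw [hs]; simp [Nat.mul_assoc])
  simp only [List.length_range, List.map_const', List.sum_replicate, smul_eq_mul, mul_one] at key
  obtain ⟨k1, k2⟩ := key
  simp only [CTable.rank, Timed.val_bind, Timed.time_bind, Timed.val_pure, Timed.time_pure,
    Timed.time_tick]
  rw [← hb]
  refine ⟨?_, by omega⟩
  rw [k1, Nat.add_sub_cancel' hle]
  conv_rhs => rw [← Nat.div_add_mod' i w]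
  rw [popcount_add, Nat.zero_add]

namespace Store

variable {E : Type}

/-- The finished hash table `S` has the contents of the table `T`. For a compacted table this
means that the bit vector marks the full slots, that the samples are ranks, and that the content
of a full slot is found at its rank. -/
def Represents (δ w : ℕ) : Store E → Table E → Prop
  | .plain T', T => T' = T
  | .compacted C, T => C.size = T.size ∧ (∀ i < T.size, C.bit i = (T.slot i).isSome) ∧
      (∀ b, b * (δ * w) < T.size → C.sample b = popcount C.bit 0 (b * (δ * w))) ∧
      ∀ i < T.size, ∀ e, T.slot i = some e → C.entry (popcount C.bit 0 i) = some e

/-- The second component of the state of a scan is the rank of the current slot. -/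
def Valid : Store E → ℕ × ℕ → Prop
  | .plain _, _ => True
  | .compacted C, q => q.2 = popcount C.bit 0 q.1

variable {δ w : ℕ} {S : Store E} {T : Table E}

theorem Represents.size_eq (h : S.Represents δ w T) : S.size = T.size := by
  cases S with
  | plain T' => exact congrArg Table.size h
  | compacted C => exact h.1

theorem Represents.start_spec (hδ : 0 < δ) (h : S.Represents δ w T) {i : ℕ}
    (hi : i < T.size) :
    (S.start δ w i).val.1 = i ∧ S.Valid (S.start δ w i).val ∧ (S.start δ w i).time ≤ δ + 2 := by
  cases S with
  | plain T' => simp [Store.start, Store.Valid]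
  | compacted C =>
    obtain ⟨r1, r2⟩ := C.rank_spec hδ i
      (h.2.2.1 _ (lt_of_le_of_lt (Nat.div_mul_le_self _ _) hi))
    simp [Store.start, Store.Valid, r1, r2]

theorem Represents.read_spec (h : S.Represents δ w T) {q : ℕ × ℕ} (hi : q.1 < T.size)
    (hq : S.Valid q) : (S.read q).val = T.slot q.1 ∧ (S.read q).time ≤ 2 := by
  cases S with
  | plain T' =>
    obtain rfl : T' = T := h
    simp [Store.read]
  | compacted C =>
    obtain ⟨-, h2, -, h4⟩ := h
    simp only [Store.Valid] at hq
    simp only [Store.read, Timed.val_bind, Timed.time_bind, Timed.time_tick, Timed.val_pure,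
      Timed.time_pure, h2 _ hi, hq, le_refl, and_true, add_zero]
    cases hs : T.slot q.1 with
    | none => simp
    | some e => simp [h4 _ hi e hs]

theorem Represents.advance_spec (h : S.Represents δ w T) {q : ℕ × ℕ} (hi : q.1 < T.size)
    (hq : S.Valid q) (hs : T.slot q.1 ≠ none) :
    (S.advance q).val.1 = nextSlot T.size q.1 ∧ S.Valid (S.advance q).val ∧
      (S.advance q).time = 1 := by
  have hsz := h.size_eq
  refine ⟨?_, ?_, rfl⟩
  · simp only [Store.advance, Timed.val_bind, Timed.val_pure, hsz, nextSlot]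
    split_ifs <;> rfl
  · cases S with
    | plain T' => trivial
    | compacted C =>
      obtain ⟨-, h2, -, -⟩ := h
      simp only [Store.Valid] at hq
      simp only [Store.advance, Timed.val_bind, Timed.val_pure, Store.Valid]
      split_ifs
      · simp [popcount]
      · have : (T.slot q.1).isSome = true := Option.isSome_iff_ne_none.2 hs
        simp [popcount_zero_succ, h2 _ hi, this, hq]

/-- Collecting returns the run of the table. -/
theorem Represents.collect_spec (h : S.Represents δ w T) (k : ℕ) {q : ℕ × ℕ}
    (hi : q.1 < T.size) (hq : S.Valid q) :
    (S.collect k q).val = T.run k q.1 ∧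
      (S.collect k q).time ≤ 3 * (T.run k q.1).length + 2 := by
  induction k generalizing q with
  | zero => simp [Store.collect, Table.run]
  | succ k ih =>
    obtain ⟨r1, r2⟩ := h.read_spec hi hq
    unfold Store.collect Table.run
    simp only [Timed.val_bind, Timed.time_bind, r1]
    cases hs : T.slot q.1 with
    | none => simpa using r2
    | some e =>
      obtain ⟨a1, a2, a3⟩ := h.advance_spec hi hq (by simp [hs])
      obtain ⟨i1, i2⟩ := ih (q := (S.advance q).val)
        (by rw [a1, Table.nextSlot_eq_mod hi]; exact Nat.mod_lt _ (by omega)) a2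
      rw [a1] at i1 i2
      simp only [Timed.val_bind, Timed.time_bind, Timed.val_pure, Timed.time_pure, i1, a3,
        List.length_cons]
      exact ⟨trivial, by omega⟩

/-- Searching decides membership in the run of the table. -/
theorem Represents.search_spec {σ : ℕ} {S : Store (Word σ)} {T : Table (Word σ)}
    (h : S.Represents δ w T) (y : Word σ) (k : ℕ) {q : ℕ × ℕ}
    (hi : q.1 < T.size) (hq : S.Valid q) :
    (S.search w y k q).val = decide (y ∈ T.run k q.1) ∧
      (S.search w y k q).time ≤
        (4 + packedLength σ w y.length) * (T.run k q.1).length + 2 := by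
  induction k generalizing q with
  | zero => simp [Store.search, Table.run]
  | succ k ih =>
    obtain ⟨r1, r2⟩ := h.read_spec hi hq
    unfold Store.search Table.run
    simp only [Timed.val_bind, Timed.time_bind, r1]
    cases hs : T.slot q.1 with
    | none => simpa using r2
    | some z =>
      simp only [Timed.val_bind, Timed.time_bind, Timed.time_tick, List.length_cons,
        List.mem_cons, Nat.mul_add, Nat.mul_one]
      by_cases hz : z = y
      · simp only [hz, if_true, Timed.val_pure, Timed.time_pure, true_or, decide_true, true_and]
        omega
      · obtain ⟨a1, a2, a3⟩ := h.advance_spec hi hq (by simp [hs])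
        obtain ⟨i1, i2⟩ := ih (q := (S.advance q).val)
          (by rw [a1, Table.nextSlot_eq_mod hi]; exact Nat.mod_lt _ (by omega)) a2
        rw [a1] at i1 i2
        simp only [hz, Ne.symm hz, if_false, Timed.val_bind, Timed.time_bind, i1, a3, false_or]
        exact ⟨trivial, by omega⟩

end Store

/-- The step of the compaction, as a sampling step followed by the treatment of the slot. -/
theorem compactStep_eq {E : Type} (δ w : ℕ) (wc : E → ℕ) (T : Table E) (C : CTable E) (i : ℕ) :
    compactStep δ w wc T C i =
      (tick 1 >>= fun _ =>
        (if i % (δ * w) = 0 then do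
            tick 1
            pure { C with sample := Function.update C.sample (i / (δ * w)) C.count }
          else pure C) >>= fun C' =>
        match T.slot i with
        | none => pure C'
        | some e => do
          tick (2 + wc e)
          pure { C' with
            bit := Function.update C'.bit i true
            entry := Function.update C'.entry C'.count (some e)
            count := C'.count + 1 }) := by
  unfold compactStep
  split_ifs
  · exact congrArg (tick 1 >>= ·) (funext fun _ => (Timed.bind_assoc _ _ _).symm)
  · rfl

theorem Table.compact_spec {E : Type} {δ w : ℕ} (hz : 0 < δ * w) (W : ℕ) (wc : E → ℕ) (T : Table E)
    (hwc : ∀ i < T.size, ∀ e, T.slot i = some e → wc e ≤ W) :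
    (Store.compacted (T.compact δ w wc).val).Represents δ w T ∧
      (T.compact δ w wc).time ≤ 1 + T.size * (4 + W) := by
  set full : ℕ → Bool := fun i => (T.slot i).isSome with hfull
  have key := Timed.foldlM_spec (compactStep δ w wc T) (fun _ => 4 + W)
    (fun l C => C.size = T.size ∧ (∀ i, C.bit i = (decide (i < l.length) && full i)) ∧
      C.count = popcount full 0 l.length ∧
      (∀ b, b * (δ * w) < l.length → C.sample b = popcount full 0 (b * (δ * w))) ∧
      ∀ i < l.length, ∀ e, T.slot i = some e → C.entry (popcount full 0 i) = some e)
    (List.range T.size)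
    (by
      intro l₁ a l₂ C hl hI
      obtain ⟨rfl, ha⟩ := eq_length_of_range_eq_append hl
      obtain ⟨i1, i2, i3, i4, i5⟩ := hI
      rw [List.length_append, List.length_singleton]
      generalize l₁.length = n at *
      -- the sampling step
      obtain ⟨C', hC', ht, j1, j2, j3, j4, j5⟩ : ∃ C' : Timed (CTable E),
          C' = (if n % (δ * w) = 0 then do
            tick 1
            pure { C with sample := Function.update C.sample (n / (δ * w)) C.count }
            else pure C) ∧ C'.time ≤ 1 ∧ C'.val.size = C.size ∧ C'.val.bit = C.bit ∧
            C'.val.entry = C.entry ∧ C'.val.count = C.count ∧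
            ∀ b, b * (δ * w) < n + 1 → C'.val.sample b = popcount full 0 (b * (δ * w)) := by
        refine ⟨_, rfl, ?_⟩
        split_ifs with h0
        · refine ⟨by simp, rfl, rfl, rfl, rfl, fun b hb => ?_⟩
          simp only [Timed.val_bind, Timed.val_pure]
          by_cases hbn : b = n / (δ * w)
          · rw [hbn, Function.update_self, i3, Nat.div_mul_cancel (Nat.dvd_of_mod_eq_zero h0)]
          · rw [Function.update_of_ne hbn]
            refine i4 b (lt_of_le_of_ne (by omega) fun hc => hbn ?_)
            exact (Nat.div_eq_of_eq_mul_left hz hc.symm).symm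
        · refine ⟨by simp, rfl, rfl, rfl, rfl, fun b hb => ?_⟩
          refine i4 b (lt_of_le_of_ne (by omega) fun hc => h0 ?_)
          rw [← hc, Nat.mul_mod_left]
      rw [compactStep_eq]
      simp only [Timed.Spec, Timed.val_bind, Timed.time_bind, Timed.time_tick]
      rw [← hC']
      cases hs : T.slot n with
      | none =>
        have hfn : full n = false := by simp [hfull, hs]
        refine ⟨⟨j1.trans i1, fun i => ?_, ?_, j5, fun i hi e he => ?_⟩, ?_⟩
        · simp only [Timed.val_pure, j2, i2]
          by_cases hin : i = n
          · simp [hin, hfn]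
          · have : i < n + 1 ↔ i < n := by omega
            simp only [this]
        · simp only [Timed.val_pure]
          rw [j4, i3, popcount_zero_succ, hfn]; rfl
        · simp only [Timed.val_pure]
          rw [j3]
          refine i5 i (lt_of_le_of_ne (by omega) ?_) e he
          rintro rfl; simp [hs] at he
        · simp only [Timed.time_pure]; omega
      | some e₀ =>
        have hfn : full n = true := by simp [hfull, hs]
        have hW := hwc n ha e₀ hs
        simp only [Timed.val_bind, Timed.time_bind, Timed.time_tick, Timed.val_pure,
          Timed.time_pure, j2, j3, j4]
        refine ⟨⟨j1.trans i1, fun i => ?_, ?_, j5, fun i hi e he => ?_⟩, ?_⟩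
        · by_cases hin : i = n
          · simp [hin, hfn]
          · have : i < n + 1 ↔ i < n := by omega
            simp only [Function.update_of_ne hin, i2, this]
        · rw [i3, popcount_zero_succ, hfn]; rfl
        · by_cases hin : i = n
          · subst hin
            rw [i3, Function.update_self]
            rw [hs] at he; exact he
          · rw [Function.update_of_ne, i5 i (by omega) e he]
            have h1 : popcount full 0 (i + 1) ≤ popcount full 0 n :=
              popcount_zero_mono full (by omega)
            rw [popcount_zero_succ] at h1
            have : full i = true := by simp [hfull, he]
            rw [this] at h1
            rw [i3]
            simp at h1
            omega
        · omega)
    ⟨T.size, fun _ => false, fun _ => 0, fun _ => none, 0⟩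
    (by simp [popcount])
  simp only [List.length_range, List.map_const', List.sum_replicate, smul_eq_mul] at key
  obtain ⟨⟨k1, k2, k3, k4, k5⟩, k6⟩ := key
  simp only [Table.compact, Timed.val_bind, Timed.time_bind, Timed.time_tick]
  refine ⟨?_, by omega⟩
  generalize (List.foldlM (compactStep δ w wc T) _ (List.range T.size)).val = C at *
  have hpop : ∀ n ≤ T.size, popcount C.bit 0 n = popcount full 0 n := by
    intro n hn
    refine popcount_congr fun i hi => ?_
    rw [k2, decide_eq_true (by omega), Bool.true_and]
  refine ⟨k1, fun i hi => ?_, fun b hb => ?_, fun i hi e he => ?_⟩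
  · rw [k2, decide_eq_true hi, Bool.true_and]
  · rw [hpop _ hb.le]; exact k4 b hb
  · rw [hpop _ hi.le]; exact k5 i hi e he

theorem Table.finish_spec {E : Type} {r : ℕ} (p : Params r) (hz : 0 < p.δ * p.w) (W : ℕ) (wc : E → ℕ) (T : Table E)
    (hwc : ∀ i < T.size, ∀ e, T.slot i = some e → wc e ≤ W) :
    (T.finish p wc).val.Represents p.δ p.w T ∧
      (T.finish p wc).time ≤ 1 + T.size * (4 + W) := by
  unfold Table.finish
  split_ifs
  · obtain ⟨c1, c2⟩ := Table.compact_spec hz W wc T hwc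
    exact ⟨c1, c2⟩
  · exact ⟨rfl, by simp⟩

/-! ### Edit operations and keys -/

theorem insertIdx_length_append {A : Type} (u v : List A) (a : A) :
    (u ++ v).insertIdx u.length a = u ++ a :: v := by
  induction u with
  | nil => rfl
  | cons b u ih => simpa using ih

namespace EditStep

variable {A B : Type}

theorem map (f : A → B) {x y : List A} (h : EditStep x y) : EditStep (x.map f) (y.map f) := by
  cases h with
  | insert u v a => simpa using EditStep.insert (u.map f) (v.map f) (f a)
  | delete u v a => simpa using EditStep.delete (u.map f) (v.map f) (f a)
  | subst u v a b => simpa using EditStep.subst (u.map f) (v.map f) (f a) (f b)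

theorem set (x : List A) {i : ℕ} (hi : i < x.length) (a : A) : EditStep x (x.set i a) := by
  have := EditStep.subst (x.take i) (x.drop (i + 1)) x[i] a
  rwa [List.getElem_cons_drop,
    List.take_append_drop, ← (List.set_eq_take_append_cons_drop).trans (if_pos hi)] at this

theorem eraseIdx (x : List A) {i : ℕ} (hi : i < x.length) : EditStep x (x.eraseIdx i) := by
  have := EditStep.delete (x.take i) (x.drop (i + 1)) x[i]
  rwa [← List.eraseIdx_eq_take_drop_succ, List.getElem_cons_drop,
    List.take_append_drop] at this

theorem insertIdx (x : List A) {i : ℕ} (hi : i ≤ x.length) (a : A) :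
    EditStep x (x.insertIdx i a) := by
  have := EditStep.insert (x.take i) (x.drop i) a
  have h2 := insertIdx_length_append (x.take i) (x.drop i) a
  rw [List.take_append_drop, List.length_take_of_le hi] at h2
  rwa [List.take_append_drop, ← h2] at this

end EditStep

theorem editDistLE_one_iff {A : Type} {x y : List A} :
    EditDistLE 1 x y ↔ x = y ∨ EditStep x y := by
  simp [EditDistLE]

section Keys

variable {σ : ℕ}

theorem plainKey_injective : Function.Injective (plainKey (σ := σ)) :=
  List.map_injective_iff.2 (Option.some_injective _)

theorem none_notMem_plainKey (x : Word σ) : none ∉ plainKey x := by simp [plainKey]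

theorem substKey_append_cons (u v : Word σ) (a : Fin σ) :
    substKey (u ++ a :: v) u.length = plainKey u ++ none :: plainKey v := by
  simp [substKey, plainKey]

theorem insertKey_append (u v : Word σ) :
    insertKey (u ++ v) u.length = plainKey u ++ none :: plainKey v := by
  have := insertIdx_length_append (plainKey u) (plainKey v) none
  simpa [insertKey, plainKey] using this

theorem plainKey_append_none_inj {u v u' v' : Word σ}
    (h : plainKey u ++ none :: plainKey v = plainKey u' ++ none :: plainKey v') :
    u = u' ∧ v = v' := by
  induction u generalizing u' with
  | nil =>
    cases u' with
    | nil => exact ⟨rfl, plainKey_injective (by simpa [plainKey] using h)⟩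
    | cons b u' => simp [plainKey] at h
  | cons a u ih =>
    cases u' with
    | nil => simp [plainKey] at h
    | cons b u' =>
      simp only [plainKey, List.map_cons, List.cons_append, List.cons.injEq,
        Option.some.injEq] at h
      obtain ⟨h1, h2⟩ := ih h.2
      exact ⟨by rw [h.1, h1], h2⟩

theorem exists_eq_append_cons (x : Word σ) {i : ℕ} (hi : i < x.length) :
    ∃ u a v, x = u ++ a :: v ∧ u.length = i :=
  ⟨x.take i, x[i], x.drop (i + 1), by simp, by simp; omega⟩

theorem none_mem_substKey (x : Word σ) {i : ℕ} (hi : i < x.length) : none ∈ substKey x i := by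
  obtain ⟨u, a, v, rfl, rfl⟩ := exists_eq_append_cons x hi
  rw [substKey_append_cons]; simp

theorem none_mem_insertKey (x : Word σ) {i : ℕ} (hi : i ≤ x.length) : none ∈ insertKey x i := by
  have := insertKey_append (x.take i) (x.drop i)
  rw [List.take_append_drop, List.length_take_of_le hi] at this
  rw [this]; simp

/-- The keys under which the substitution store keeps the characters of the words in `D`. -/
def substKeys (D : List (Word σ)) : List (Key σ) :=
  D.flatMap fun x => x.zipIdx.map fun aj => substKey x aj.2

/-- The keys of the words of length `l` in `D`. -/
def exactKeys (D : List (Word σ)) (l : ℕ) : List (Key σ) :=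
  (D.filter fun x => x.length = l).map plainKey

theorem mem_substKeys {D : List (Word σ)} {k : Key σ} :
    k ∈ substKeys D ↔ ∃ x ∈ D, ∃ i < x.length, k = substKey x i := by
  simp only [substKeys, List.mem_flatMap, List.mem_map, Prod.exists]
  constructor
  · rintro ⟨x, hx, a, j, hj, rfl⟩
    exact ⟨x, hx, j, (List.mem_zipIdx' hj).1, rfl⟩
  · rintro ⟨x, hx, i, hi, rfl⟩
    exact ⟨x, hx, x[i], i, List.mk_mem_zipIdx_iff_getElem?.2 (by simp), rfl⟩

theorem length_substKeys (D : List (Word σ)) : (substKeys D).length = totalLength D := by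
  simp [substKeys, totalLength, List.length_flatMap]

theorem length_exactKeys (D : List (Word σ)) (l : ℕ) :
    (exactKeys D l).length = countLength D l := by
  simp [exactKeys, countLength, List.countP_eq_length_filter]

theorem nodup_exactKeys {D : List (Word σ)} (hD : D.Nodup) (l : ℕ) : (exactKeys D l).Nodup :=
  (hD.filter _).map plainKey_injective

/-- If every substitution list has one element, a key of the substitution store determines the
word and the position it comes from. -/
theorem substKey_inj {D : List (Word σ)}
    (h1 : ∀ u v : Word σ, (substList D u v).Nonempty → (substList D u v).card = 1)
    {x y : Word σ} (hx : x ∈ D) (hy : y ∈ D) {i j : ℕ} (hi : i < x.length) (hj : j < y.length)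
    (h : substKey x i = substKey y j) : x = y ∧ i = j := by
  obtain ⟨u, a, v, rfl, rfl⟩ := exists_eq_append_cons x hi
  obtain ⟨u', b, v', rfl, rfl⟩ := exists_eq_append_cons y hj
  rw [substKey_append_cons, substKey_append_cons] at h
  obtain ⟨rfl, rfl⟩ := plainKey_append_none_inj h
  have ha : a ∈ substList D u v := by simpa [substList] using hx
  have hb : b ∈ substList D u v := by simpa [substList] using hy
  obtain ⟨d, hd⟩ := Finset.card_eq_one.1 (h1 u v ⟨a, ha⟩)
  rw [hd, Finset.mem_singleton] at ha hb
  rw [ha, hb]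
  exact ⟨rfl, rfl⟩

theorem nodup_substKeys {D : List (Word σ)} (hD : D.Nodup)
    (h1 : ∀ u v : Word σ, (substList D u v).Nonempty → (substList D u v).card = 1) :
    (substKeys D).Nodup := by
  have hmem : ∀ {x : Word σ} {k}, k ∈ x.zipIdx.map (fun aj => substKey x aj.2) →
      ∃ i < x.length, k = substKey x i := by
    intro x k hk
    obtain ⟨⟨a, j⟩, hj, rfl⟩ := List.mem_map.1 hk
    exact ⟨j, (List.mem_zipIdx' hj).1, rfl⟩
  refine List.nodup_flatMap.2 ⟨fun x hx => ?_, ?_⟩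
  · have : x.zipIdx.map (fun aj => substKey x aj.2) =
        (List.range' 0 x.length).map (substKey x) := by
      rw [← List.zipIdx_map_snd 0 x, List.map_map]; rfl
    rw [this]
    refine List.Nodup.map_on (fun i hi j hj hij => ?_) List.nodup_range'
    simp only [List.mem_range'_1, zero_le, zero_add, true_and] at hi hj
    exact (substKey_inj h1 hx hx hi hj hij).2
  · refine hD.imp_of_mem fun hx hy hxy => ?_
    rw [Function.onFun, List.disjoint_left]
    intro k hk hk'
    obtain ⟨i, hi, rfl⟩ := hmem hk
    obtain ⟨j, hj, h⟩ := hmem hk'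
    exact hxy (substKey_inj h1 hx hy hi hj h).1

end Keys

/-! ### The contents of the tables -/

theorem capacity_zero (α : ℝ) : capacity α 0 = 0 := by simp [capacity]

/-- A table has an empty slot, as the load factor is less than one. -/
theorem lt_capacity {α : ℝ} (hα₀ : 0 < α) (hα₁ : α < 1) {N : ℕ} (hN : 0 < N) :
    N < capacity α N := by
  have hN' : (0 : ℝ) < N := by exact_mod_cast hN
  have : (N : ℝ) < N / α := by rw [lt_div_iff₀ hα₀]; nlinarith
  exact_mod_cast this.trans_le (Nat.le_ceil _)

theorem le_mul_capacity {α : ℝ} (hα₀ : 0 < α) (N : ℕ) : (N : ℝ) ≤ α * capacity α N := by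
  rw [mul_comm, ← div_le_iff₀ hα₀]
  exact Nat.le_ceil _

theorem capacity_le {α : ℝ} {M : ℕ} (hM : 1 / α + 1 ≤ M) (N : ℕ) : capacity α N ≤ M * N := by
  rcases Nat.eq_zero_or_pos N with rfl | hN
  · simp [capacity_zero]
  · refine Nat.ceil_le.2 ?_
    have hN' : (0 : ℝ) ≤ N := by positivity
    push_cast
    calc (N : ℝ) / α = 1 / α * N := by ring
      _ ≤ M * N := by gcongr; linarith

section Tables

variable {σ r : ℕ} (α : ℝ) (sig : ℕ → Fin (2 ^ r)) (H : Key σ → ℕ) (D : List (Word σ))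

/-- The contents of the hash table of the words of length `l`, with their hash values. -/
def exactItems (l : ℕ) : List (Word σ × ℕ) :=
  (D.filter fun x => x.length = l).map fun x => (x, H (plainKey x))

/-- The characters and signatures in the substitution store, with their hash values. -/
def substItems : List ((Fin σ × Fin (2 ^ r)) × ℕ) :=
  D.flatMap fun x => x.zipIdx.map fun aj =>
    ((aj.1, sig (H (substKey x aj.2))), H (substKey x aj.2))

/-- The hash table of the words of length `l`, before compaction. -/
noncomputable def exactTable (l : ℕ) : Table (Word σ) :=
  (Table.empty _ (capacity α (countLength D l))).insertAll (fun y => y.length + 1)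
    (exactItems H D l)

/-- The hash table of the substitution store, before compaction. -/
noncomputable def substTable : Table (Fin σ × Fin (2 ^ r)) :=
  (Table.empty _ (capacity α (totalLength D))).insertAll (fun _ => 1) (substItems sig H D)

theorem map_snd_exactItems (l : ℕ) :
    (exactItems H D l).map Prod.snd = (exactKeys D l).map H := by
  simp [exactItems, exactKeys]

theorem map_snd_substItems : (substItems sig H D).map Prod.snd = (substKeys D).map H := by
  simp [substItems, substKeys, List.map_flatMap, Function.comp_def]

theorem length_exactItems (l : ℕ) : (exactItems H D l).length = countLength D l := by
  rw [← List.length_map Prod.snd, map_snd_exactItems, List.length_map, length_exactKeys]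

theorem length_substItems : (substItems sig H D).length = totalLength D := by
  rw [← List.length_map Prod.snd, map_snd_substItems, List.length_map, length_substKeys]

variable {α}

theorem exactItems_eq_nil_or_lt (hα₀ : 0 < α) (hα₁ : α < 1) (l : ℕ) : exactItems H D l = [] ∨
    (exactItems H D l).length < capacity α (countLength D l) := by
  rw [← List.length_eq_zero_iff, length_exactItems]
  exact (Nat.eq_zero_or_pos _).imp id (lt_capacity hα₀ hα₁)

theorem substItems_eq_nil_or_lt (hα₀ : 0 < α) (hα₁ : α < 1) : substItems sig H D = [] ∨
    (substItems sig H D).length < capacity α (totalLength D) := by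
  rw [← List.length_eq_zero_iff, length_substItems]
  exact (Nat.eq_zero_or_pos _).imp id (lt_capacity hα₀ hα₁)

theorem holds_exactTable (hα₀ : 0 < α) (hα₁ : α < 1) (l : ℕ) :
    (exactTable α H D l).Holds (exactItems H D l) ∧
      (exactTable α H D l).size = capacity α (countLength D l) :=
  Table.holds_insertAll _ _ _ (exactItems_eq_nil_or_lt H D hα₀ hα₁ l)

theorem holds_substTable (hα₀ : 0 < α) (hα₁ : α < 1) :
    (substTable α sig H D).Holds (substItems sig H D) ∧
      (substTable α sig H D).size = capacity α (totalLength D) :=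
  Table.holds_insertAll _ _ _ (substItems_eq_nil_or_lt sig H D hα₀ hα₁)

end Tables

/-- A step of building a table: inserting `e`, when the list of all elements is
`L₁ ++ (e, p) :: L₂`. -/
theorem Table.insert_insertAll_spec {E : Type} (wc : E → ℕ) {t : ℕ} {L L₁ L₂ : List (E × ℕ)}
    {e : E} {p : ℕ} (hL : L = L₁ ++ (e, p) :: L₂) (ht : L = [] ∨ L.length < t) :
    (((Table.empty E t).insertAll wc L₁).insert wc e p).Spec
      (Table.runBound t (L.map Prod.snd) p + 2 + wc e)
      fun T => T = (Table.empty E t).insertAll wc (L₁ ++ [(e, p)]) := by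
  have hlt : L₁.length < t := by
    rcases ht with h | h
    · simp [h] at hL
    · simp [hL] at h; omega
  obtain ⟨h1, h2⟩ := Table.holds_insertAll wc t L₁ (Or.inr hlt)
  obtain ⟨-, -, h3⟩ := Table.insert_spec wc h1 (by omega) e p
  refine ⟨(Table.insertAll_append_singleton _ _ _ _ _).symm, ?_⟩
  have h4 := h1.run_length_le_runBound (by omega) p
  rw [h2] at h4 h3
  have h5 : Table.runBound t (L₁.map Prod.snd) p ≤ Table.runBound t (L.map Prod.snd) p :=
    Table.runBound_mono ((by simp [hL] : L₁.Sublist L).map _) p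
  omega

/-! ### The construction -/

section Build

variable {σ r : ℕ}

/-- The maximal length of a word in the list. -/
def maxLength (D : List (Word σ)) : ℕ := D.foldl (fun m x => max m x.length) 0

theorem maxLength_append_singleton (D : List (Word σ)) (x : Word σ) :
    maxLength (D ++ [x]) = max (maxLength D) x.length := by
  simp [maxLength]

theorem length_le_maxLength {D : List (Word σ)} {x : Word σ} (hx : x ∈ D) :
    x.length ≤ maxLength D := by
  induction D using List.reverseRecOn with
  | nil => simp at hx
  | append_singleton D y ih =>
    rw [maxLength_append_singleton]
    rcases List.mem_append.1 hx with h | h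
    · exact (ih h).trans (le_max_left _ _)
    · rw [List.mem_singleton.1 h]; exact le_max_right _ _

theorem totalLength_append_singleton (D : List (Word σ)) (x : Word σ) :
    totalLength (D ++ [x]) = totalLength D + x.length := by
  simp [totalLength]

theorem maxLength_le_totalLength (D : List (Word σ)) : maxLength D ≤ totalLength D := by
  induction D using List.reverseRecOn with
  | nil => simp [maxLength]
  | append_singleton D y ih =>
    rw [maxLength_append_singleton, totalLength_append_singleton]
    omega

variable (α : ℝ) (H : Key σ → ℕ) (D : List (Word σ))

/-- A bound for the length of the run met when searching the word `y` in the exact dictionary. -/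
noncomputable def exactRun (y : Word σ) : ℕ :=
  Table.runBound (capacity α (countLength D y.length)) ((exactKeys D y.length).map H)
    (H (plainKey y))

/-- A bound for the length of the run met when looking up `k` in the substitution store. -/
noncomputable def substRun (k : Key σ) : ℕ :=
  Table.runBound (capacity α (totalLength D)) ((substKeys D).map H) (H k)

/-- A bound for the time of inserting the word `x`, with hashing constant `c`. -/
noncomputable def insertCost (c : ℕ) (x : Word σ) : ℕ :=
  c * (x.length + 1) + c + (exactRun α H D x + x.length + 3) +
    (x.zipIdx.map fun aj => c + substRun α H D (substKey x aj.2) + 4).sum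

/-- A bound for the time of the construction. -/
noncomputable def buildCost (c : ℕ) : ℕ :=
  (D.map fun x => x.length + 1).sum + (maxLength D + 1) + D.length +
    ((List.range (maxLength D + 1)).map fun l => capacity α (countLength D l) + 1).sum +
    (capacity α (totalLength D) + 1) + (D.map (insertCost α H D c)).sum +
    ((List.range (maxLength D + 1)).map fun l =>
      1 + capacity α (countLength D l) * (l + 5)).sum +
    (1 + capacity α (totalLength D) * 5)

/-- The data structure `Q` represents the hash tables filled with the words of `D` and their
characters. -/
def OneErrorDict.IsDictFor (Q : OneErrorDict σ r) (p : Params r) : Prop :=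
  Q.maxLen = maxLength D ∧
    (∀ l ≤ maxLength D, (Q.exact l).Represents p.δ p.w (exactTable p.loadFactor H D l)) ∧
    Q.subst.Represents p.δ p.w (substTable p.loadFactor p.sig H D)

variable {α} {c : ℕ} {D}

theorem exactItems_append_singleton (D : List (Word σ)) (x : Word σ) (l : ℕ) :
    exactItems H (D ++ [x]) l =
      exactItems H D l ++ if x.length = l then [(x, H (plainKey x))] else [] := by
  unfold exactItems
  by_cases h : x.length = l <;> simp [h]

theorem insertWord_spec (p : Params r) (O : HashOracle σ)
    (hα₀ : 0 < p.loadFactor) (hα₁ : p.loadFactor < 1)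
    (hinc : IsIncremental c O.preCost O.evalCost) {D₁ D₂ : List (Word σ)} {x : Word σ}
    (hD : D = D₁ ++ x :: D₂)
    (s : (ℕ → Table (Word σ)) × Table (Fin σ × Fin (2 ^ r)))
    (hs₁ : ∀ l ≤ maxLength D, s.1 l =
      (Table.empty _ (capacity p.loadFactor (countLength D l))).insertAll (fun y => y.length + 1)
        (exactItems O.hash D₁ l))
    (hs₂ : s.2 = (Table.empty _ (capacity p.loadFactor (totalLength D))).insertAll (fun _ => 1)
        (substItems p.sig O.hash D₁)) :
    (insertWord p O s x).Spec (insertCost p.loadFactor O.hash D c x) fun s =>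
      (∀ l ≤ maxLength D, s.1 l =
        (Table.empty _ (capacity p.loadFactor (countLength D l))).insertAll
          (fun y => y.length + 1) (exactItems O.hash (D₁ ++ [x]) l)) ∧
      s.2 = (Table.empty _ (capacity p.loadFactor (totalLength D))).insertAll (fun _ => 1)
        (substItems p.sig O.hash (D₁ ++ [x])) := by
  have hxD : x ∈ D := by simp [hD]
  have hself : O.evalCost (plainKey x) (plainKey x) ≤ c :=
    (hinc _).2 _ (editDistLE_one_iff.2 (Or.inl rfl))
  have hpre : O.preCost (plainKey x) ≤ c * (x.length + 1) := by
    simpa [plainKey] using (hinc (plainKey x)).1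
  unfold insertWord
  refine Timed.Spec.bind (t₁ := c * (x.length + 1)) (Q := fun _ => True) ⟨trivial, hpre⟩
    (t₂ := c + (exactRun p.loadFactor O.hash D x + x.length + 3) + (x.zipIdx.map fun aj =>
      c + substRun p.loadFactor O.hash D (substKey x aj.2) + 4).sum) (fun _ _ => ?_)
    (by unfold insertCost; omega)
  refine Timed.Spec.bind (t₁ := c) (Q := fun hv => hv = O.hash (plainKey x)) ⟨rfl, hself⟩
    (fun hv hhv => ?_) (Nat.add_assoc _ _ _).ge
  subst hhv
  refine Timed.Spec.bind (Q := fun T => T =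
      (Table.empty _ (capacity p.loadFactor (countLength D x.length))).insertAll
        (fun y => y.length + 1) (exactItems O.hash (D₁ ++ [x]) x.length)) (t₁ := _) ?_
    (fun T hT => ?_) le_rfl
  · rw [hs₁ _ (length_le_maxLength hxD), exactItems_append_singleton, if_pos rfl]
    have := Table.insert_insertAll_spec (fun y : Word σ => y.length + 1)
      (L := exactItems O.hash D x.length) (L₁ := exactItems O.hash D₁ x.length)
      (L₂ := exactItems O.hash D₂ x.length) (e := x) (p := O.hash (plainKey x))
      (t := capacity p.loadFactor (countLength D x.length))
      (by rw [hD]; simp [exactItems]) (exactItems_eq_nil_or_lt O.hash D hα₀ hα₁ x.length)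
    refine ⟨this.1, this.2.trans ?_⟩
    rw [map_snd_exactItems]
    unfold exactRun
    omega
  · -- the characters of `x`
    set f : (Fin σ × ℕ) → (Fin σ × Fin (2 ^ r)) × ℕ := fun aj =>
      ((aj.1, p.sig (O.hash (substKey x aj.2))), O.hash (substKey x aj.2)) with hf
    have hloop := Timed.foldlM_spec
      (fun S aj => do
        let hj ← O.eval x (substKey x aj.2)
        tick 1
        Table.insert (fun _ => 1) S (aj.1, p.sig hj) hj)
      (fun aj => c + substRun p.loadFactor O.hash D (substKey x aj.2) + 4)
      (fun l S => S = (Table.empty _ (capacity p.loadFactor (totalLength D))).insertAll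
        (fun _ => 1) (substItems p.sig O.hash D₁ ++ l.map f))
      x.zipIdx
      (by
        rintro l₁ ⟨a, j⟩ l₂ S hl rfl
        have hj : j < x.length := by
          have : (a, j) ∈ x.zipIdx := by rw [hl]; simp
          exact (List.mem_zipIdx' this).1
        have hev : O.evalCost (plainKey x) (substKey x j) ≤ c :=
          (hinc _).2 _ (editDistLE_one_iff.2 (Or.inr
            (EditStep.set _ (by simpa [plainKey] using hj) _)))
        have := Table.insert_insertAll_spec (fun _ : Fin σ × Fin (2 ^ r) => 1)
          (L := substItems p.sig O.hash D) (L₁ := substItems p.sig O.hash D₁ ++ l₁.map f)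
          (L₂ := l₂.map f ++ substItems p.sig O.hash D₂)
          (e := (a, p.sig (O.hash (substKey x j)))) (p := O.hash (substKey x j))
          (t := capacity p.loadFactor (totalLength D))
          (by
            rw [hD]
            simp only [substItems, List.flatMap_append, List.flatMap_cons]
            rw [hl]
            simp [hf])
          (substItems_eq_nil_or_lt p.sig O.hash D hα₀ hα₁)
        refine ⟨?_, ?_⟩
        · rw [List.map_append, ← List.append_assoc]
          exact this.1
        · have h2 := this.2
          rw [map_snd_substItems] at h2
          simp only [Timed.time_bind, Timed.time_tick]
          change O.evalCost (plainKey x) (substKey x j) + (1 + (Table.insert _ _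
            (a, p.sig (O.hash (substKey x j))) (O.hash (substKey x j))).time) ≤ _
          unfold substRun
          omega)
      s.2 (by simpa using hs₂)
    refine Timed.Spec.bind (t₁ := _) (t₂ := 0) hloop (fun S hS => ⟨⟨fun l hl => ?_, ?_⟩, le_rfl⟩)
      le_rfl
    · simp only [Timed.val_pure]
      by_cases hlx : l = x.length
      · rw [hlx, Function.update_self, hT]
      · rw [Function.update_of_ne hlx, hs₁ l hl, exactItems_append_singleton,
          if_neg (Ne.symm hlx), List.append_nil]
    · simp only [Timed.val_pure, hS]
      congr 1
      simp [substItems, hf]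

theorem Table.alloc_spec {E : Type} (t : ℕ) :
    (Table.alloc (E := E) t).Spec (t + 1) fun T => T = Table.empty E t := ⟨rfl, le_rfl⟩

theorem build_spec (p : Params r) (O : HashOracle σ) (hz : 0 < p.δ * p.w)
    (hα₀ : 0 < p.loadFactor) (hα₁ : p.loadFactor < 1)
    (hinc : IsIncremental c O.preCost O.evalCost) :
    (build p O D).Spec (buildCost p.loadFactor O.hash D c) fun Q => Q.IsDictFor O.hash D p := by
  unfold build buildCost
  simp only [Nat.add_assoc]
  -- total and maximal length
  refine Timed.Spec.bind (Q := fun nL => nL = (totalLength D, maxLength D))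
    (Timed.foldlM_spec _ (fun x => x.length + 1)
      (fun l s => s = (totalLength l, maxLength l)) D ?_ (0, 0) rfl) ?_ le_rfl
  · rintro l₁ x l₂ s - rfl
    refine ⟨?_, le_rfl⟩
    rw [totalLength_append_singleton, maxLength_append_singleton]
    rfl
  rintro _ rfl
  rw [← Nat.add_assoc (maxLength D)]
  refine Timed.Spec.bind (Q := fun _ => True) (t₁ := maxLength D + 1) ⟨trivial, le_rfl⟩
    (fun _ _ => ?_) le_rfl
  -- the numbers of words
  refine Timed.Spec.bind (Q := fun cnt => cnt = countLength D) (t₁ := D.length) ?_ ?_ le_rfl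
  · have := Timed.foldlM_spec
      (fun (f : ℕ → ℕ) (x : Word σ) => do
        tick 1
        pure (Function.update f x.length (f x.length + 1)))
      (fun _ => 1) (fun l f => f = countLength l) D
      (by
        rintro l₁ x l₂ f - rfl
        refine ⟨?_, le_rfl⟩
        funext l
        simp only [Timed.val_bind, Timed.val_pure]
        by_cases hl : l = x.length
        · subst hl; simp [countLength]
        · simp [Function.update_of_ne hl, countLength, Ne.symm hl])
      (fun _ => 0) (by funext l; simp [countLength])
    simpa only [List.map_const', List.sum_replicate, smul_eq_mul, mul_one] using this
  rintro _ rfl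
  -- empty tables
  refine Timed.Spec.bind (Q := fun tabs => ∀ l ≤ maxLength D,
      tabs l = Table.empty (Word σ) (capacity p.loadFactor (countLength D l)))
    (t₁ := ((List.range (maxLength D + 1)).map fun l =>
      capacity p.loadFactor (countLength D l) + 1).sum) ?_ ?_ le_rfl
  · have := Timed.foldlM_spec
      (fun (f : ℕ → Table (Word σ)) l => do
        let T ← Table.alloc (capacity p.loadFactor (countLength D l))
        pure (Function.update f l T))
      (fun l => capacity p.loadFactor (countLength D l) + 1)
      (fun ls f => ∀ l ∈ ls,
        f l = Table.empty (Word σ) (capacity p.loadFactor (countLength D l)))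
      (List.range (maxLength D + 1))
      (by
        rintro l₁ a l₂ f - hI
        refine ⟨fun l hl => ?_, le_rfl⟩
        simp only [Timed.val_bind, Timed.val_pure]
        by_cases hla : l = a
        · subst hla; rw [Function.update_self]; rfl
        · rw [Function.update_of_ne hla]
          exact hI l (by simpa [hla] using hl))
      (fun _ => ⟨0, fun _ => none⟩) (by simp)
    exact ⟨fun l hl => this.1 l (by simp; omega), this.2⟩
  intro tabs htabs
  rw [← Nat.add_assoc (capacity p.loadFactor (totalLength D)) 1]
  refine Timed.Spec.bind (Table.alloc_spec _) ?_ le_rfl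
  rintro _ rfl
  -- insertions
  refine Timed.Spec.bind
    (Timed.foldlM_spec (insertWord p O) (insertCost p.loadFactor O.hash D c)
      (fun D₁ (s : (ℕ → Table (Word σ)) × Table (Fin σ × Fin (2 ^ r))) =>
      (∀ l ≤ maxLength D, s.1 l =
        (Table.empty _ (capacity p.loadFactor (countLength D l))).insertAll
          (fun y => y.length + 1) (exactItems O.hash D₁ l)) ∧
      s.2 = (Table.empty _ (capacity p.loadFactor (totalLength D))).insertAll (fun _ => 1)
        (substItems p.sig O.hash D₁)) D
      (fun D₁ x D₂ s hD hs => insertWord_spec p O hα₀ hα₁ hinc hD s hs.1 hs.2)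
      (tabs, Table.empty _ _) ⟨fun l hl => htabs l hl, rfl⟩) ?_ le_rfl
  rintro ⟨T₁, T₂⟩ ⟨h1, h2⟩
  dsimp only at h1 h2
  -- final form
  refine Timed.Spec.bind (Q := fun ex => ∀ l ≤ maxLength D,
      (ex l).Represents p.δ p.w (exactTable p.loadFactor O.hash D l))
    (t₁ := ((List.range (maxLength D + 1)).map fun l =>
      1 + capacity p.loadFactor (countLength D l) * (l + 5)).sum) ?_ ?_ le_rfl
  · have := Timed.foldlM_spec
      (fun (f : ℕ → Store (Word σ)) l => do
        let S ← (T₁ l).finish p (fun y => y.length + 1)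
        pure (Function.update f l S))
      (fun l => 1 + capacity p.loadFactor (countLength D l) * (l + 5))
      (fun ls f => ∀ l ∈ ls,
        (f l).Represents p.δ p.w (exactTable p.loadFactor O.hash D l))
      (List.range (maxLength D + 1))
      (by
        intro l₁ a l₂ f hl hI
        have ha : a ≤ maxLength D := by
          have : a ∈ List.range (maxLength D + 1) := by rw [hl]; simp
          rw [List.mem_range] at this; omega
        obtain ⟨e1, e2⟩ := holds_exactTable O.hash D hα₀ hα₁ a
        obtain ⟨f1, f2⟩ := Table.finish_spec p hz (a + 1) (fun y : Word σ => y.length + 1)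
          (exactTable p.loadFactor O.hash D a) (by
            intro i hi e he
            obtain ⟨_, hp⟩ := e1.exists_mem_of_slot hi he
            simp only [exactItems, List.mem_map, List.mem_filter] at hp
            obtain ⟨y, ⟨-, hy⟩, hye⟩ := hp
            rw [← (Prod.mk.inj hye).1]
            simp only [decide_eq_true_eq] at hy
            omega)
        have hT : T₁ a = exactTable p.loadFactor O.hash D a := h1 a ha
        simp only [Timed.Spec, Timed.val_bind, Timed.val_pure, Timed.time_bind, Timed.time_pure, hT]
        refine ⟨fun l hl => ?_, ?_⟩
        · by_cases hla : l = a
          · subst hla; rw [Function.update_self]; exact f1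
          · rw [Function.update_of_ne hla]
            exact hI l (by simpa [hla] using hl)
        · rw [e2] at f2
          refine f2.trans (le_of_eq ?_)
          ring)
      (fun _ => .plain ⟨0, fun _ => none⟩) (by simp)
    exact ⟨fun l hl => this.1 l (by simp; omega), this.2⟩
  intro ex hex
  obtain ⟨-, s2⟩ := holds_substTable p.sig O.hash D hα₀ hα₁
  have hT : T₂ = substTable p.loadFactor p.sig O.hash D := h2
  have hfin : (T₂.finish p (fun _ => 1)).Spec (1 + capacity p.loadFactor (totalLength D) * 5)
      fun S => S.Represents p.δ p.w (substTable p.loadFactor p.sig O.hash D) := by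
    rw [hT, ← s2]
    exact Table.finish_spec p hz 1 (fun _ => 1) _ (fun _ _ _ _ => le_rfl)
  exact Timed.Spec.bind (t₂ := 0) hfin (fun S hS => ⟨⟨rfl, hex, hS⟩, le_rfl⟩) le_rfl

end Build

/-! ### Queries -/

section Query

variable {σ r : ℕ} (p : Params r) (H : Key σ → ℕ) (D : List (Word σ)) (c : ℕ)

/-- A bound for the time of checking whether the candidate `y` is in the dictionary. -/
noncomputable def checkCost (y : Word σ) : ℕ :=
  c + p.δ + 6 + (4 + packedLength σ p.w y.length) * exactRun p.loadFactor H D y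

/-- The characters, with their signatures, met in looking up `k` in the substitution store. -/
noncomputable def candRun (k : Key σ) : List (Fin σ × Fin (2 ^ r)) :=
  (substTable p.loadFactor p.sig H D).run (substTable p.loadFactor p.sig H D).size
    (H k % (substTable p.loadFactor p.sig H D).size)

/-- A bound for the time of looking up the key `k` in the substitution store and checking the
candidates `f a`, where `a` is a character found. -/
noncomputable def lookupCost (k : Key σ) (f : Fin σ → Word σ) : ℕ :=
  c + p.δ + 8 + 4 * (candRun p H D k).length +
    ((candRun p H D k).map fun e => 2 + checkCost p H D c (f e.1)).sum

/-- A bound for the time of a query. -/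
noncomputable def queryCost (x : Word σ) : ℕ :=
  c * (x.length + 1) + 3 * (x.length + 1) + checkCost p H D c x +
    ((List.range x.length).map fun i => 2 + checkCost p H D c (x.eraseIdx i)).sum +
    ((List.range x.length).map fun i =>
      lookupCost p H D c (substKey x i) fun a => x.set i a).sum +
    ((List.range (x.length + 1)).map fun i =>
      lookupCost p H D c (insertKey x i) fun a => x.insertIdx i a).sum

variable {p H D c}

theorem length_candRun_le (hα₀ : 0 < p.loadFactor) (hα₁ : p.loadFactor < 1) (k : Key σ) :
    (candRun p H D k).length ≤ substRun p.loadFactor H D k := by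
  obtain ⟨h1, h2⟩ := holds_substTable p.sig H D hα₀ hα₁
  unfold candRun substRun
  rcases Nat.eq_zero_or_pos (totalLength D) with h0 | h0
  · have : (substTable p.loadFactor p.sig H D).size = 0 := by rw [h2, h0, capacity_zero]
    simp [this, Table.run]
  · have := h1.run_length_le_runBound
      (by rw [h2, length_substItems]; exact lt_capacity hα₀ hα₁ h0) (H k)
    rw [map_snd_substItems] at this
    rwa [h2] at this ⊢

/-- If `u a v` is in the dictionary, then `a` is found in looking up `u φ v`. -/
theorem mem_candRun (hα₀ : 0 < p.loadFactor) (hα₁ : p.loadFactor < 1) {u v : Word σ} {a : Fin σ}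
    (h : u ++ a :: v ∈ D) :
    (a, p.sig (H (plainKey u ++ none :: plainKey v))) ∈
      candRun p H D (plainKey u ++ none :: plainKey v) := by
  refine (holds_substTable p.sig H D hα₀ hα₁).1.mem_run_of_mem ?_
  rw [substItems, List.mem_flatMap]
  refine ⟨_, h, List.mem_map.2 ⟨(a, u.length), ?_, ?_⟩⟩
  · rw [List.mk_mem_zipIdx_iff_getElem?]; simp
  · simp only [substKey_append_cons]

variable {Q : OneErrorDict σ r} {O : HashOracle σ}

/-- Checking a candidate is correct and takes at most `checkCost` steps. -/
theorem OneErrorDict.check_spec (hQ : Q.IsDictFor O.hash D p) (hδ : 0 < p.δ)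
    (hα₀ : 0 < p.loadFactor) (hα₁ : p.loadFactor < 1)
    (hinc : IsIncremental c O.preCost O.evalCost) {x y : Word σ}
    (hxy : EditDistLE 1 (plainKey x) (plainKey y)) :
    (Q.check p O x y).Spec (checkCost p O.hash D c y)
      fun l => ∀ z, z ∈ l ↔ z = y ∧ y ∈ D := by
  obtain ⟨hm, he, -⟩ := hQ
  have hcontains : (Q.contains p O x y).Spec (c + p.δ + 5 +
      (4 + packedLength σ p.w y.length) * exactRun p.loadFactor O.hash D y)
      fun b => b = true ↔ y ∈ D := by
    unfold OneErrorDict.contains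
    refine Timed.Spec.bind (t₁ := 1) (Q := fun _ => True) ⟨trivial, le_rfl⟩ (t₂ := c + p.δ + 4 +
      (4 + packedLength σ p.w y.length) * exactRun p.loadFactor O.hash D y) (fun _ _ => ?_)
      (by omega)
    obtain ⟨h1, h2⟩ := holds_exactTable O.hash D hα₀ hα₁ y.length
    have hcount : y ∈ D → 0 < countLength D y.length := fun hy =>
      List.countP_pos_iff.2 ⟨y, hy, by simp⟩
    split_ifs with hc
    · refine ⟨?_, Nat.zero_le _⟩
      simp only [Timed.val_pure, Bool.false_eq_true, false_iff]
      intro hy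
      have hle := length_le_maxLength hy
      rcases hc with hc | hc
      · omega
      · rw [(he _ hle).size_eq, h2] at hc
        have := lt_capacity hα₀ hα₁ (hcount hy)
        omega
    · push Not at hc
      rw [hm] at hc
      have hrep := he _ hc.1
      have hsize := hrep.size_eq
      have hpos : 0 < (exactTable p.loadFactor O.hash D y.length).size := by
        rw [← hsize]; omega
      have hlt : (exactItems O.hash D y.length).length <
          (exactTable p.loadFactor O.hash D y.length).size := by
        rw [h2]
        refine (exactItems_eq_nil_or_lt O.hash D hα₀ hα₁ y.length).elim (fun h => ?_) id
        rw [h, ← h2]; exact hpos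
      refine Timed.Spec.bind (t₁ := c) (Q := fun hv => hv = O.hash (plainKey y))
        ⟨rfl, (hinc _).2 _ hxy⟩ (t₂ := p.δ + 4 +
          (4 + packedLength σ p.w y.length) * exactRun p.loadFactor O.hash D y)
        (fun hv hhv => ?_) (by omega)
      subst hhv
      dsimp only
      rw [hsize]
      have hi := Nat.mod_lt (O.hash (plainKey y)) hpos
      obtain ⟨s1, s2, s3⟩ := hrep.start_spec hδ hi
      refine Timed.Spec.bind (Q := fun q => q.1 = O.hash (plainKey y) %
          (exactTable p.loadFactor O.hash D y.length).size ∧ (Q.exact y.length).Valid q)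
        ⟨⟨s1, s2⟩, s3⟩ (t₂ := 2 +
          (4 + packedLength σ p.w y.length) * exactRun p.loadFactor O.hash D y)
        (fun q hq => ?_) (by omega)
      obtain ⟨c1, c2⟩ := hrep.search_spec y (exactTable p.loadFactor O.hash D y.length).size
        (q := q) (by rw [hq.1]; exact hi) hq.2
      rw [hq.1] at c1 c2
      refine ⟨?_, ?_⟩
      · rw [c1]
        simp only [decide_eq_true_eq]
        constructor
        · intro hy
          obtain ⟨j, hj, hs⟩ := Table.exists_slot_of_mem_run _ _ _ hi _ hy
          obtain ⟨_, hp⟩ := h1.exists_mem_of_slot hj hs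
          simp only [exactItems, List.mem_map, List.mem_filter] at hp
          obtain ⟨z, ⟨hz, -⟩, hzy⟩ := hp
          rw [← (Prod.mk.inj hzy).1]; exact hz
        · intro hy
          refine h1.mem_run_of_mem ?_
          simp only [exactItems, List.mem_map, List.mem_filter]
          exact ⟨y, ⟨hy, by simp⟩, rfl⟩
      · refine c2.trans ?_
        have := h1.run_length_le_runBound hlt (O.hash (plainKey y))
        rw [map_snd_exactItems] at this
        rw [Nat.add_comm]
        refine Nat.add_le_add_left (Nat.mul_le_mul_left _ ?_) _
        unfold exactRun
        rwa [h2] at this ⊢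
  unfold OneErrorDict.check
  refine Timed.Spec.bind hcontains (t₂ := 1) (fun b hb => ⟨fun z => ?_, le_rfl⟩)
    (by unfold checkCost; omega)
  simp only [Timed.val_bind, Timed.val_pure]
  rw [← hb]
  cases b <;> simp

theorem OneErrorDict.checkAll_spec (hQ : Q.IsDictFor O.hash D p) (hδ : 0 < p.δ)
    (hα₀ : 0 < p.loadFactor) (hα₁ : p.loadFactor < 1)
    (hinc : IsIncremental c O.preCost O.evalCost) {x : Word σ} (cands : List (Word σ))
    (hc : ∀ y ∈ cands, EditDistLE 1 (plainKey x) (plainKey y)) :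
    (Q.checkAll p O x cands).Spec (cands.map fun y => 2 + checkCost p O.hash D c y).sum
      fun out => ∀ y, y ∈ out ↔ y ∈ cands ∧ y ∈ D := by
  unfold OneErrorDict.checkAll
  refine Timed.foldlM_spec _ _ (fun l out => ∀ y, y ∈ out ↔ y ∈ l ∧ y ∈ D) cands ?_ [] (by simp)
  rintro l₁ y l₂ out hl hI
  have hy : y ∈ cands := by rw [hl]; simp
  refine Timed.Spec.bind (t₁ := 2) (Q := fun _ => True) ⟨trivial, le_rfl⟩ (fun _ _ => ?_) le_rfl
  refine Timed.Spec.bind (t₂ := 0) (check_spec hQ hδ hα₀ hα₁ hinc (hc y hy))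
    (fun l hl => ⟨fun z => ?_, le_rfl⟩) le_rfl
  rw [Timed.val_pure, List.mem_append, hI, hl, List.mem_append, List.mem_singleton]
  constructor
  · rintro (h | ⟨rfl, h⟩)
    · exact ⟨Or.inl h.1, h.2⟩
    · exact ⟨Or.inr rfl, h⟩
  · rintro ⟨h | rfl, h'⟩
    · exact Or.inl ⟨h, h'⟩
    · exact Or.inr ⟨rfl, h'⟩

theorem OneErrorDict.candidates_spec (hQ : Q.IsDictFor O.hash D p) (hδ : 0 < p.δ)
    (hinc : IsIncremental c O.preCost O.evalCost) {x : Word σ} {k : Key σ}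
    (hk : EditDistLE 1 (plainKey x) k) :
    (Q.candidates p O x k).Spec (c + p.δ + 6 + 4 * (candRun p O.hash D k).length)
      fun l => l = ((candRun p O.hash D k).filter fun e => e.2 = p.sig (O.hash k)).map
        Prod.fst := by
  obtain ⟨-, -, hrep⟩ := hQ
  have hsize := hrep.size_eq
  unfold OneErrorDict.candidates
  refine Timed.Spec.bind (t₁ := 1) (Q := fun _ => True) ⟨trivial, le_rfl⟩
    (t₂ := c + p.δ + 5 + 4 * (candRun p O.hash D k).length) (fun _ _ => ?_) (by omega)
  split_ifs with h0
  · refine ⟨?_, Nat.zero_le _⟩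
    rw [hsize] at h0
    simp [candRun, h0, Table.run]
  · have hpos : 0 < (substTable p.loadFactor p.sig O.hash D).size := by omega
    refine Timed.Spec.bind (t₁ := c) (Q := fun hv => hv = O.hash k)
      ⟨rfl, (hinc _).2 _ hk⟩ (t₂ := p.δ + 5 + 4 * (candRun p O.hash D k).length)
      (fun hv hhv => ?_) (by omega)
    subst hhv
    rw [hsize]
    have hi := Nat.mod_lt (O.hash k) hpos
    obtain ⟨s1, s2, s3⟩ := hrep.start_spec hδ hi
    refine Timed.Spec.bind (Q := fun q => q.1 = O.hash k %
        (substTable p.loadFactor p.sig O.hash D).size ∧ Q.subst.Valid q)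
      ⟨⟨s1, s2⟩, s3⟩ (t₂ := 3 + 4 * (candRun p O.hash D k).length) (fun q hq => ?_) (by omega)
    obtain ⟨c1, c2⟩ := hrep.collect_spec (substTable p.loadFactor p.sig O.hash D).size
      (q := q) (by rw [hq.1]; exact hi) hq.2
    rw [hq.1] at c1 c2
    change _ = candRun p O.hash D k at c1
    change _ ≤ 3 * (candRun p O.hash D k).length + 2 at c2
    refine Timed.Spec.bind (Q := fun l => l = candRun p O.hash D k) ⟨c1, c2⟩
      (t₂ := 1 + (candRun p O.hash D k).length) ?_ (by omega)
    rintro _ rfl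
    exact ⟨rfl, le_rfl⟩

/-- The loop over the positions of the wild card, for substitutions or for insertions. -/
theorem OneErrorDict.lookups_spec (hQ : Q.IsDictFor O.hash D p) (hδ : 0 < p.δ)
    (hα₀ : 0 < p.loadFactor) (hα₁ : p.loadFactor < 1)
    (hinc : IsIncremental c O.preCost O.evalCost) {x : Word σ} (n : ℕ) (key : ℕ → Key σ)
    (f : ℕ → Fin σ → Word σ) (hkey : ∀ i < n, EditDistLE 1 (plainKey x) (key i))
    (hf : ∀ i < n, ∀ a, EditDistLE 1 (plainKey x) (plainKey (f i a))) :
    ((List.range n).foldlM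
      (fun out i => do
        tick 2
        let l ← Q.candidates p O x (key i)
        let res ← Q.checkAll p O x (l.map (f i))
        pure (out ++ res))
      []).Spec ((List.range n).map fun i => lookupCost p O.hash D c (key i) (f i)).sum
      fun out => ∀ y, y ∈ out ↔ y ∈ D ∧ ∃ i < n, ∃ e ∈ candRun p O.hash D (key i),
        e.2 = p.sig (O.hash (key i)) ∧ y = f i e.1 := by
  have := Timed.foldlM_spec
    (fun (out : List (Word σ)) i => do
        tick 2
        let l ← Q.candidates p O x (key i)
        let res ← Q.checkAll p O x (l.map (f i))
        pure (out ++ res))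
    (fun i => lookupCost p O.hash D c (key i) (f i))
    (fun l out => ∀ y, y ∈ out ↔ y ∈ D ∧ ∃ i ∈ l, ∃ e ∈ candRun p O.hash D (key i),
        e.2 = p.sig (O.hash (key i)) ∧ y = f i e.1) (List.range n) ?_ [] (by simp)
  · simpa only [List.mem_range] using this
  rintro l₁ i l₂ out hl hI
  have hi : i < n := by rw [← List.mem_range, hl]; simp
  refine Timed.Spec.bind (t₁ := 2) (Q := fun _ => True) ⟨trivial, le_rfl⟩
    (t₂ := c + p.δ + 6 + 4 * (candRun p O.hash D (key i)).length +
      ((candRun p O.hash D (key i)).map fun e => 2 + checkCost p O.hash D c (f i e.1)).sum)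
    (fun _ _ => ?_) (by unfold lookupCost; omega)
  refine Timed.Spec.bind (candidates_spec hQ hδ hinc (hkey i hi)) (fun l hl => ?_) le_rfl
  subst hl
  refine Timed.Spec.bind (t₂ := 0) (checkAll_spec hQ hδ hα₀ hα₁ hinc _ ?_)
    (fun res hres => ⟨fun y => ?_, le_rfl⟩) ?_
  · intro y hy
    obtain ⟨a, -, rfl⟩ := List.mem_map.1 hy
    exact hf i hi a
  · rw [Timed.val_pure, List.mem_append, hI, hres]
    simp only [List.mem_map, List.mem_filter, decide_eq_true_eq, List.mem_append,
      List.mem_singleton, or_and_right, exists_or, exists_eq_left]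
    constructor
    · rintro (⟨h, i, hi, e, he⟩ | ⟨⟨a, ⟨e, ⟨he, hs⟩, rfl⟩, rfl⟩, h⟩)
      · exact ⟨h, Or.inl ⟨i, hi, e, he⟩⟩
      · exact ⟨h, Or.inr ⟨e, he, hs, rfl⟩⟩
    · rintro ⟨h, ⟨i, hi, e, he⟩ | ⟨e, he, hs, rfl⟩⟩
      · exact Or.inl ⟨h, i, hi, e, he⟩
      · exact Or.inr ⟨⟨_, ⟨e, ⟨he, hs⟩, rfl⟩, rfl⟩, h⟩
  · rw [List.map_map, List.map_map, Nat.add_zero]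
    exact (List.filter_sublist.map _).sum_le_sum (by simp)

/-- The query is correct for every outcome of the hash function. -/
theorem OneErrorDict.query_spec (hQ : Q.IsDictFor O.hash D p) (hδ : 0 < p.δ)
    (hα₀ : 0 < p.loadFactor) (hα₁ : p.loadFactor < 1)
    (hinc : IsIncremental c O.preCost O.evalCost) (x : Word σ) :
    (Q.query p O x).Spec (queryCost p O.hash D c x)
      fun out => ∀ y, y ∈ out ↔ y ∈ D ∧ EditDistLE 1 x y := by
  have hstep : ∀ {y : Word σ}, EditStep x y → EditDistLE 1 (plainKey x) (plainKey y) :=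
    fun h => editDistLE_one_iff.2 (Or.inr (h.map some))
  have hpre : O.preCost (plainKey x) ≤ c * (x.length + 1) := by
    simpa [plainKey] using (hinc (plainKey x)).1
  unfold OneErrorDict.query queryCost
  simp only [Nat.add_assoc]
  refine Timed.Spec.bind (t₁ := c * (x.length + 1)) (Q := fun _ => True)
    ⟨trivial, hpre⟩ (fun _ _ => ?_) le_rfl
  refine Timed.Spec.bind (t₁ := 3 * (x.length + 1)) (Q := fun _ => True) ⟨trivial, le_rfl⟩
    (fun _ _ => ?_) le_rfl
  refine Timed.Spec.bind
    (check_spec hQ hδ hα₀ hα₁ hinc (editDistLE_one_iff.2 (Or.inl rfl)))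
    (fun out₀ h₀ => ?_) le_rfl
  have hdel := checkAll_spec hQ hδ hα₀ hα₁ hinc (x := x)
    ((List.range x.length).map fun i => x.eraseIdx i) (by
      intro y hy
      obtain ⟨i, hi, rfl⟩ := List.mem_map.1 hy
      exact hstep (EditStep.eraseIdx x (List.mem_range.1 hi)))
  rw [List.map_map] at hdel
  refine Timed.Spec.bind hdel (fun out₁ h₁ => ?_) le_rfl
  refine Timed.Spec.bind (lookups_spec hQ hδ hα₀ hα₁ hinc x.length (substKey x)
    (fun i a => x.set i a)
    (fun i hi => editDistLE_one_iff.2 (Or.inr (EditStep.set _ (by simpa [plainKey] using hi) _)))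
    (fun i hi a => hstep (EditStep.set x hi a))) (fun out₂ h₂ => ?_) le_rfl
  refine Timed.Spec.bind (t₂ := 0) (lookups_spec hQ hδ hα₀ hα₁ hinc (x.length + 1) (insertKey x)
    (fun i a => x.insertIdx i a)
    (fun i hi => editDistLE_one_iff.2 (Or.inr (EditStep.insertIdx _
      (by simp [plainKey]; omega) _)))
    (fun i hi a => hstep (EditStep.insertIdx x (by omega) a)))
    (fun out₃ h₃ => ⟨fun y => ?_, le_rfl⟩) le_rfl
  simp only [Timed.val_pure, List.mem_append, h₀, h₁, h₂, h₃, editDistLE_one_iff]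
  constructor
  · rintro (((⟨rfl, h⟩ | ⟨h', h⟩) | ⟨h, i, hi, e, -, -, rfl⟩) | ⟨h, i, hi, e, -, -, rfl⟩)
    · exact ⟨h, Or.inl rfl⟩
    · obtain ⟨i, hi, rfl⟩ := List.mem_map.1 h'
      exact ⟨h, Or.inr (EditStep.eraseIdx x (List.mem_range.1 hi))⟩
    · exact ⟨h, Or.inr (EditStep.set x hi _)⟩
    · exact ⟨h, Or.inr (EditStep.insertIdx x (by omega) _)⟩
  · rintro ⟨hy, rfl | hstep⟩
    · exact Or.inl (Or.inl (Or.inl ⟨rfl, hy⟩))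
    · cases hstep with
      | insert u v a =>
        refine Or.inr ⟨hy, u.length, by simp,
          (a, p.sig (O.hash (plainKey u ++ none :: plainKey v))), ?_⟩
        rw [insertKey_append]
        exact ⟨mem_candRun hα₀ hα₁ hy, rfl, (insertIdx_length_append u v a).symm⟩
      | delete u v a =>
        refine Or.inl (Or.inl (Or.inr ⟨List.mem_map.2 ⟨u.length, by simp, ?_⟩, hy⟩))
        rw [List.eraseIdx_append_of_length_le le_rfl]; simp
      | subst u v b a =>
        refine Or.inl (Or.inr ⟨hy, u.length, by simp,
          (a, p.sig (O.hash (plainKey u ++ none :: plainKey v))), ?_⟩)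
        rw [substKey_append_cons]
        exact ⟨mem_candRun hα₀ hα₁ hy, rfl, by simp⟩

end Query

/-! ### Expected costs -/

theorem Measurable.natCast_ennreal {Ω : Type*} [MeasurableSpace Ω] {f : Ω → ℕ} (hf : Measurable f) :
    Measurable fun ω => (f ω : ℝ≥0∞) := measurable_from_nat.comp hf

/-- The random number `f` of steps has mean at most `b`. -/
def MeanLE {Ω : Type*} [MeasurableSpace Ω] (P : Measure Ω) (f : Ω → ℕ) (b : ℕ) : Prop :=
  Measurable f ∧ ∫⁻ ω, (f ω : ℝ≥0∞) ∂P ≤ b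

namespace MeanLE

variable {Ω : Type*} [MeasurableSpace Ω] {P : Measure Ω} {f g : Ω → ℕ} {a b : ℕ}

theorem const [IsProbabilityMeasure P] (a : ℕ) : MeanLE P (fun _ => a) a := ⟨measurable_const, by simp⟩

theorem mono (h : MeanLE P f a) (hab : a ≤ b) : MeanLE P f b :=
  ⟨h.1, h.2.trans (by exact_mod_cast hab)⟩

theorem add (hf : MeanLE P f a) (hg : MeanLE P g b) : MeanLE P (fun ω => f ω + g ω) (a + b) := by
  refine ⟨hf.1.add hg.1, ?_⟩
  simp only [Nat.cast_add]
  rw [lintegral_add_left (hf.1.natCast_ennreal)]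
  exact add_le_add hf.2 hg.2

theorem const_mul (k : ℕ) (hf : MeanLE P f a) : MeanLE P (fun ω => k * f ω) (k * a) := by
  refine ⟨measurable_const.mul hf.1, ?_⟩
  simp only [Nat.cast_mul]
  rw [lintegral_const_mul _ (hf.1.natCast_ennreal)]
  gcongr
  exact hf.2

theorem list_sum [IsProbabilityMeasure P] {I : Type*} (L : List I) {f : I → Ω → ℕ} {b : I → ℕ}
    (h : ∀ i ∈ L, MeanLE P (f i) (b i)) :
    MeanLE P (fun ω => (L.map fun i => f i ω).sum) (L.map b).sum := by
  induction L with
  | nil => simpa using const (P := P) 0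
  | cons i L ih =>
    simp only [List.map_cons, List.sum_cons]
    exact (h i (by simp)).add (ih fun j hj => h j (by simp [hj]))

end MeanLE

section Costs

variable {σ r : ℕ} {D : List (Word σ)} {RS : ℕ} {RE : ℕ → ℕ} {Ω : Type*} [MeasurableSpace Ω]
  {P : Measure Ω} [IsProbabilityMeasure P] {h : Key σ → Ω → ℕ} {α : ℝ} {M c : ℕ}

theorem dependsOn_exactRun (α : ℝ) (D : List (Word σ)) (y : Word σ) :
    DependsOn (fun H : Key σ → ℕ => exactRun α H D y)
      (((plainKey y :: exactKeys D y.length).toFinset : Finset (Key σ)) : Set (Key σ)) := by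
  intro H H' hH
  have h1 : (exactKeys D y.length).map H = (exactKeys D y.length).map H' :=
    List.map_congr_left fun k hk => hH k (by simp [hk])
  simp only [exactRun, h1, hH (plainKey y) (by simp)]

theorem dependsOn_substRun (α : ℝ) (D : List (Word σ)) (k : Key σ) :
    DependsOn (fun H : Key σ → ℕ => substRun α H D k)
      (((k :: substKeys D).toFinset : Finset (Key σ)) : Set (Key σ)) := by
  intro H H' hH
  have h1 : (substKeys D).map H = (substKeys D).map H' :=
    List.map_congr_left fun k hk => hH k (by simp [hk])
  simp only [substRun, h1, hH k (by simp)]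

/-- What a lookup collects depends only on the hash values of the key looked up and of the keys in
the substitution store. -/
theorem dependsOn_candRun (p : Params r) (D : List (Word σ)) (k : Key σ) :
    DependsOn (fun H : Key σ → ℕ => candRun p H D k)
      (((k :: substKeys D).toFinset : Finset (Key σ)) : Set (Key σ)) := by
  intro H H' hH
  have h1 : substItems p.sig H D = substItems p.sig H' D := by
    refine List.flatMap_congr fun x hx => List.map_congr_left fun aj haj => ?_
    have : substKey x aj.2 ∈ substKeys D :=
      mem_substKeys.2 ⟨x, hx, aj.2, (List.mem_zipIdx' haj).1, rfl⟩
    rw [hH (substKey x aj.2) (by simp [this])]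
  simp only [candRun, substTable, h1, hH k (by simp)]

theorem meanLE_exactRun (hα₀ : 0 < α) (hα₁ : α < 1)
    (hM : 1 / α * (1 - α * Real.exp (1 - α))⁻¹ ^ 2 ≤ M) (hD : D.Nodup)
    (hRE : ∀ l, 0 < countLength D l → capacity α (countLength D l) ∣ RE l)
    (hh : FullyRandom P (hashRange RS RE) h) (y : Word σ) :
    MeanLE P (fun ω => exactRun α (fun k => h k ω) D y) M := by
  refine ⟨hh.measurable_comp (dependsOn_exactRun α D y), ?_⟩
  rcases Nat.eq_zero_or_pos (countLength D y.length) with h0 | h0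
  · simp [exactRun, h0, capacity_zero, Table.runBound]
  · have hrange : ∀ z : Word σ, z.length = y.length →
        capacity α (countLength D y.length) ∣ hashRange RS RE (plainKey z) := by
      intro z hz
      rw [hashRange, if_neg (none_notMem_plainKey z)]
      simpa [plainKey, hz] using hRE _ h0
    refine (hh.lintegral_runBound_le hα₀ hα₁ (exactKeys D y.length) (nodup_exactKeys hD _)
      (plainKey y) (fun k hk => ?_) (hrange y rfl) ?_).trans ?_
    · obtain ⟨z, hz, rfl⟩ := List.mem_map.1 hk
      exact hrange z (by simpa using (List.mem_filter.1 hz).2)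
    · rw [length_exactKeys]; exact le_mul_capacity hα₀ _
    · rw [← ENNReal.ofReal_natCast]; exact ENNReal.ofReal_le_ofReal hM

theorem meanLE_substRun (hα₀ : 0 < α) (hα₁ : α < 1)
    (hM : 1 / α * (1 - α * Real.exp (1 - α))⁻¹ ^ 2 ≤ M) (hD : D.Nodup)
    (h1 : ∀ u v : Word σ, (substList D u v).Nonempty → (substList D u v).card = 1)
    (hRS : 0 < totalLength D → capacity α (totalLength D) ∣ RS)
    (hh : FullyRandom P (hashRange RS RE) h) {k : Key σ} (hk : none ∈ k) :
    MeanLE P (fun ω => substRun α (fun k => h k ω) D k) M := by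
  refine ⟨hh.measurable_comp (dependsOn_substRun α D k), ?_⟩
  rcases Nat.eq_zero_or_pos (totalLength D) with h0 | h0
  · simp [substRun, h0, capacity_zero, Table.runBound]
  · have hrange : ∀ k' : Key σ, none ∈ k' →
        capacity α (totalLength D) ∣ hashRange RS RE k' := by
      intro k' hk'
      rw [hashRange, if_pos hk']
      exact hRS h0
    refine (hh.lintegral_runBound_le hα₀ hα₁ (substKeys D) (nodup_substKeys hD h1)
      k (fun k' hk' => ?_) (hrange k hk) ?_).trans ?_
    · obtain ⟨x, -, i, hi, rfl⟩ := mem_substKeys.1 hk'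
      exact hrange _ (none_mem_substKey x hi)
    · rw [length_substKeys]; exact le_mul_capacity hα₀ _
    · rw [← ENNReal.ofReal_natCast]; exact ENNReal.ofReal_le_ofReal hM

theorem sum_map_fst_eq_sum_count {A B : Type*} [Fintype A] [DecidableEq A] (l : List (A × B))
    (g : A → ℕ) :
    (l.map fun e => g e.1).sum = ∑ a, (l.map Prod.fst).count a * g a := by
  induction l with
  | nil => simp
  | cons e l ih =>
    simp only [List.map_cons, List.sum_cons, ih, List.count_cons, add_mul, Finset.sum_add_distrib]
    rw [add_comm]
    simp

/-- The expected cost of a lookup. The number of times a character `a` is collected depends on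
the hash values of keys with a wild card, and the time of checking the candidate `f a` on those
of keys without one; so the mean of their product is the product of their means. -/
theorem meanLE_lookupCost {p : Params r} (hα₀ : 0 < p.loadFactor) (hα₁ : p.loadFactor < 1)
    (hh : FullyRandom P (hashRange RS RE) h) {k : Key σ} (hk : none ∈ k) (f : Fin σ → Word σ)
    {K : ℕ} (hK : ∀ a, MeanLE P (fun ω => checkCost p (fun k => h k ω) D c (f a)) K)
    (hS : MeanLE P (fun ω => substRun p.loadFactor (fun k => h k ω) D k) M) :
    MeanLE P (fun ω => lookupCost p (fun k => h k ω) D c k f)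
      (c + p.δ + 8 + 4 * M + M * (2 + K)) := by
  -- the number of times `a` is collected
  set N : Fin σ → (Key σ → ℕ) → ℕ := fun a H => ((candRun p H D k).map Prod.fst).count a with hN
  have hNdep : ∀ a, DependsOn (N a)
      (((k :: substKeys D).toFinset : Finset (Key σ)) : Set (Key σ)) := fun a H H' hH => by
    simp only [hN, show candRun p H D k = candRun p H' D k from dependsOn_candRun p D k hH]
  have hlen : MeanLE P (fun ω => (candRun p (fun k => h k ω) D k).length) M := by
    refine ⟨hh.measurable_comp (F := fun H => (candRun p H D k).length)
      (S := (k :: substKeys D).toFinset) fun H H' hH =>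
        congrArg List.length (dependsOn_candRun p D k hH),
      (lintegral_mono fun ω => ?_).trans hS.2⟩
    exact Nat.cast_le.2 (length_candRun_le hα₀ hα₁ k)
  have hNmeas : ∀ a, Measurable fun ω => N a fun k => h k ω := fun a =>
    hh.measurable_comp (hNdep a)
  have hCmeas : ∀ a, Measurable fun ω => 2 + checkCost p (fun k => h k ω) D c (f a) := fun a =>
    (MeanLE.add (MeanLE.const 2) (hK a)).1
  have hmul : ∀ a, Measurable fun ω => N a (fun k => h k ω) *
      (2 + checkCost p (fun k => h k ω) D c (f a)) := fun a => (hNmeas a).mul (hCmeas a)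
  have hsum : MeanLE P (fun ω => ∑ a, N a (fun k => h k ω) *
      (2 + checkCost p (fun k => h k ω) D c (f a))) (M * (2 + K)) := by
    refine ⟨Finset.measurable_sum _ fun a _ => hmul a, ?_⟩
    simp only [Nat.cast_sum]
    rw [lintegral_finsetSum _ fun a _ => (hmul a).natCast_ennreal]
    calc ∑ a, ∫⁻ ω, ((N a (fun k => h k ω) *
            (2 + checkCost p (fun k => h k ω) D c (f a)) : ℕ) : ℝ≥0∞) ∂P
        ≤ ∑ a, (∫⁻ ω, (N a (fun k => h k ω) : ℝ≥0∞) ∂P) * ((2 + K : ℕ) : ℝ≥0∞) := by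
          refine Finset.sum_le_sum fun a _ => ?_
          simp only [Nat.cast_mul]
          have hdisj : Disjoint (k :: substKeys D).toFinset
              (plainKey (f a) :: exactKeys D (f a).length).toFinset := by
            rw [Finset.disjoint_left]
            intro k₁ hk₁ hk₂
            have hsome : none ∉ k₁ := by
              rcases List.mem_cons.1 (List.mem_toFinset.1 hk₂) with rfl | hk₂
              · exact none_notMem_plainKey _
              · obtain ⟨z, -, rfl⟩ := List.mem_map.1 hk₂
                exact none_notMem_plainKey z
            rcases List.mem_cons.1 (List.mem_toFinset.1 hk₁) with rfl | hk₁
            · exact hsome hk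
            · obtain ⟨x, -, i, hi, rfl⟩ := mem_substKeys.1 hk₁
              exact hsome (none_mem_substKey x hi)
          rw [hh.lintegral_mul hdisj (F := fun H => (N a H : ℝ≥0∞))
            (G := fun H => ((2 + checkCost p H D c (f a) : ℕ) : ℝ≥0∞))
            (fun H H' hH => congrArg Nat.cast (hNdep a hH))
            (fun H H' hH => by
              have := dependsOn_exactRun p.loadFactor D (f a) hH
              dsimp only at this
              simp only [checkCost, this])]
          gcongr
          exact (MeanLE.add (MeanLE.const 2) (hK a)).2
      _ = (∫⁻ ω, ((candRun p (fun k => h k ω) D k).length : ℝ≥0∞) ∂P) *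
            ((2 + K : ℕ) : ℝ≥0∞) := by
          rw [← Finset.sum_mul, ← lintegral_finsetSum _ fun a _ =>
            (hNmeas a).natCast_ennreal]
          congr 2
          funext ω
          have := sum_map_fst_eq_sum_count (candRun p (fun k => h k ω) D k) fun _ => 1
          simp only [mul_one, List.map_const', List.sum_replicate, smul_eq_mul] at this
          rw [this, Nat.cast_sum]
      _ ≤ ((M * (2 + K) : ℕ) : ℝ≥0∞) := by
          rw [Nat.cast_mul]
          gcongr
          exact hlen.2
  have := ((MeanLE.const (P := P) (c + p.δ + 8)).add (hlen.const_mul 4)).add hsum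
  convert this using 2 with ω
  rw [lookupCost, sum_map_fst_eq_sum_count _ fun a =>
    2 + checkCost p (fun k => h k ω) D c (f a)]

theorem packedLength_mono (σ w : ℕ) {m n : ℕ} (hmn : m ≤ n) :
    packedLength σ w m ≤ packedLength σ w n := by
  unfold packedLength
  gcongr

/-- The constant of the query time, where `M` bounds the expected length of a run. -/
def queryConst (M c δ : ℕ) : ℕ :=
  2 * c + 8 + 2 * (c + δ + 6 + 8 * M) +
    3 * (c + δ + 8 + 4 * M + M * (2 + (c + δ + 6 + 8 * M)))

theorem meanLE_queryCost {p : Params r} (hα₀ : 0 < p.loadFactor) (hα₁ : p.loadFactor < 1)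
    (hM : 1 / p.loadFactor * (1 - p.loadFactor * Real.exp (1 - p.loadFactor))⁻¹ ^ 2 ≤ M)
    (hD : D.Nodup)
    (h1 : ∀ u v : Word σ, (substList D u v).Nonempty → (substList D u v).card = 1)
    (hRS : 0 < totalLength D → capacity p.loadFactor (totalLength D) ∣ RS)
    (hRE : ∀ l, 0 < countLength D l → capacity p.loadFactor (countLength D l) ∣ RE l)
    (hh : FullyRandom P (hashRange RS RE) h) (x : Word σ) (hx : 0 < x.length) {Z : ℕ}
    (hZ : 0 < Z) (hpack : packedLength σ p.w (x.length + 1) ≤ 4 * Z) :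
    MeanLE P (fun ω => queryCost p (fun k => h k ω) D c x)
      (queryConst M c p.δ * (x.length * Z)) := by
  set K := (c + p.δ + 6 + 8 * M) * Z with hK
  have hcheck : ∀ y : Word σ, y.length ≤ x.length + 1 →
      MeanLE P (fun ω => checkCost p (fun k => h k ω) D c y) K := by
    intro y hy
    refine ((MeanLE.const (c + p.δ + 6)).add ((meanLE_exactRun hα₀ hα₁ hM hD hRE hh y).const_mul
      (4 + packedLength σ p.w y.length))).mono ?_
    have h2 : 4 + packedLength σ p.w y.length ≤ 8 * Z := by
      have := packedLength_mono σ p.w hy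
      omega
    calc c + p.δ + 6 + (4 + packedLength σ p.w y.length) * M
        ≤ (c + p.δ + 6) * Z + 8 * Z * M := by
          gcongr
          exact Nat.le_mul_of_pos_right _ hZ
      _ = K := by rw [hK]; ring
  set L := (c + p.δ + 8 + 4 * M + M * (2 + (c + p.δ + 6 + 8 * M))) * Z with hL
  have hlookup : ∀ (k : Key σ) (f : Fin σ → Word σ), none ∈ k →
      (∀ a, (f a).length ≤ x.length + 1) →
      MeanLE P (fun ω => lookupCost p (fun k => h k ω) D c k f) L := by
    intro k f hk hf
    refine (meanLE_lookupCost hα₀ hα₁ hh hk f (fun a => hcheck _ (hf a))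
      (meanLE_substRun hα₀ hα₁ hM hD h1 hRS hh hk)).mono ?_
    calc c + p.δ + 8 + 4 * M + M * (2 + K)
        ≤ (c + p.δ + 8 + 4 * M) * Z + M * (2 * Z + K) := by
          gcongr
          · exact Nat.le_mul_of_pos_right _ hZ
          · exact Nat.le_mul_of_pos_right _ hZ
      _ = L := by rw [hL, hK]; ring
  have e1 := (MeanLE.const (P := P) (c * (x.length + 1) + 3 * (x.length + 1))).add
    (hcheck x (by omega))
  have e2 := MeanLE.list_sum (List.range x.length)
    (f := fun i ω => 2 + checkCost p (fun k => h k ω) D c (x.eraseIdx i)) (b := fun _ => 2 + K)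
    fun i _ => (MeanLE.const 2).add (hcheck _ ((List.length_eraseIdx_le x i).trans (by omega)))
  have e3 := MeanLE.list_sum (List.range x.length)
    (f := fun i ω => lookupCost p (fun k => h k ω) D c (substKey x i) fun a => x.set i a)
    (b := fun _ => L) fun i hi => hlookup _ _
      (none_mem_substKey x (List.mem_range.1 hi)) fun a => by simp
  have e4 := MeanLE.list_sum (List.range (x.length + 1))
    (f := fun i ω => lookupCost p (fun k => h k ω) D c (insertKey x i) fun a => x.insertIdx i a)
    (b := fun _ => L) fun i hi => hlookup _ _
      (none_mem_insertKey x (by have := List.mem_range.1 hi; omega)) fun a => by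
        rw [List.length_insertIdx]; split_ifs <;> omega
  refine (((e1.add e2).add e3).add e4).mono ?_
  simp only [List.map_const', List.sum_replicate, List.length_range, smul_eq_mul]
  have hmZ : x.length ≤ x.length * Z := Nat.le_mul_of_pos_right _ hZ
  have hZm : Z ≤ x.length * Z := Nat.le_mul_of_pos_left _ hx
  set m := x.length
  calc c * (m + 1) + 3 * (m + 1) + K + m * (2 + K) + m * L + (m + 1) * L
      ≤ c * (2 * m) + 3 * (2 * m) + m * K + m * (2 + K) + m * L + (2 * m) * L := by
        gcongr
        · omega
        · omega
        · exact Nat.le_mul_of_pos_left _ hx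
        · omega
    _ = (2 * c + 8) * m + 2 * (m * K) + 3 * (m * L) := by ring
    _ ≤ (2 * c + 8) * (m * Z) + 2 * (m * K) + 3 * (m * L) := by gcongr
    _ = queryConst M c p.δ * (m * Z) := by rw [hK, hL, queryConst]; ring

/-! ### Expected construction time -/

/-- At most one of the distinct words is empty. -/
theorem length_le_totalLength_add_one (hD : D.Nodup) : D.length ≤ totalLength D + 1 := by
  have h1 : D.length ≤ totalLength D + D.count [] := by
    clear hD
    induction D with
    | nil => simp
    | cons x D ih =>
      simp only [totalLength, List.map_cons, List.sum_cons, List.length_cons] at ih ⊢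
      cases x with
      | nil => simp; omega
      | cons a x => simp; omega
  have := List.nodup_iff_count_le_one.1 hD []
  omega

/-- Summing over the words by their lengths. -/
theorem sum_range_countLength_mul (D : List (Word σ)) (g : ℕ → ℕ) {N : ℕ}
    (hN : ∀ x ∈ D, x.length < N) :
    ((List.range N).map fun l => countLength D l * g l).sum = (D.map fun x => g x.length).sum := by
  induction D with
  | nil => simp [countLength]
  | cons x D ih =>
    have hx := hN x (by simp)
    rw [List.map_cons, List.sum_cons, ← ih fun y hy => hN y (by simp [hy])]
    change ∑ l ∈ Finset.range N, _ = _ + ∑ l ∈ Finset.range N, _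
    simp only [countLength, List.countP_cons, add_mul, Finset.sum_add_distrib]
    rw [add_comm]
    simp [hx]

/-- The constant of the construction time, where `M` bounds the expected length of a run and the
number of slots per element. -/
def buildConst (M c : ℕ) : ℕ := 6 * c + 22 * M + 30

theorem meanLE_buildCost (hα₀ : 0 < α) (hα₁ : α < 1) (hMα : 1 / α + 1 ≤ M)
    (hM : 1 / α * (1 - α * Real.exp (1 - α))⁻¹ ^ 2 ≤ M) (hD : D.Nodup)
    (h1 : ∀ u v : Word σ, (substList D u v).Nonempty → (substList D u v).card = 1)
    (hRS : 0 < totalLength D → capacity α (totalLength D) ∣ RS)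
    (hRE : ∀ l, 0 < countLength D l → capacity α (countLength D l) ∣ RE l)
    (hh : FullyRandom P (hashRange RS RE) h) (hn : 0 < totalLength D) :
    MeanLE P (fun ω => buildCost α (fun k => h k ω) D c) (buildConst M c * totalLength D) := by
  have hlen := length_le_totalLength_add_one hD
  have hmax := maxLength_le_totalLength D
  have hins : MeanLE P (fun ω => (D.map (insertCost α (fun k => h k ω) D c)).sum)
      (D.map fun x => (2 * c + M + 3) + (2 * c + M + 5) * x.length).sum := by
    refine MeanLE.list_sum D (f := fun x ω => insertCost α (fun k => h k ω) D c x) fun x _ => ?_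
    have e1 := (meanLE_exactRun hα₀ hα₁ hM hD hRE hh x).add (MeanLE.const (x.length + 3))
    have e2 := MeanLE.list_sum x.zipIdx (P := P)
      (f := fun aj ω => c + substRun α (fun k => h k ω) D (substKey x aj.2) + 4)
      (b := fun _ => c + M + 4) fun aj haj =>
        (((MeanLE.const c).add (meanLE_substRun hα₀ hα₁ hM hD h1 hRS hh
          (none_mem_substKey x (List.mem_zipIdx' haj).1))).add (MeanLE.const 4))
    refine (((MeanLE.const (c * (x.length + 1) + c)).add e1).add e2).mono ?_
    simp only [List.map_const', List.sum_replicate, List.length_zipIdx, smul_eq_mul]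
    apply le_of_eq
    ring
  have hlin : ∀ a b : ℕ, (D.map fun x => a + b * x.length).sum =
      a * D.length + b * totalLength D := by
    intro a b
    simp [List.sum_map_add, List.sum_map_mul_left, totalLength, mul_comm]
  have hrange : ∀ x ∈ D, x.length < maxLength D + 1 := fun x hx =>
    Nat.lt_succ_of_le (length_le_maxLength hx)
  have halloc : ((List.range (maxLength D + 1)).map fun l =>
      capacity α (countLength D l) + 1).sum ≤ M * D.length + (maxLength D + 1) := by
    calc _ ≤ ((List.range (maxLength D + 1)).map fun l => countLength D l * M + 1).sum := by
          refine List.sum_le_sum fun l _ => ?_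
          have := capacity_le hMα (countLength D l)
          rw [mul_comm] at this
          omega
      _ = _ := by
          rw [List.sum_map_add, sum_range_countLength_mul D (fun _ => M) hrange]
          simp [mul_comm]
  have hfinish : ((List.range (maxLength D + 1)).map fun l =>
      1 + capacity α (countLength D l) * (l + 5)).sum ≤
      (maxLength D + 1) + (5 * M * D.length + M * totalLength D) := by
    calc _ ≤ ((List.range (maxLength D + 1)).map fun l =>
            1 + countLength D l * (5 * M + M * l)).sum := by
          refine List.sum_le_sum fun l _ => ?_
          have := Nat.mul_le_mul_right (l + 5) (capacity_le hMα (countLength D l))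
          calc 1 + capacity α (countLength D l) * (l + 5)
              ≤ 1 + M * countLength D l * (l + 5) := by omega
            _ = _ := by ring
      _ = _ := by
          rw [List.sum_map_add, sum_range_countLength_mul D (fun l => 5 * M + M * l) hrange,
            hlin]
          simp
  have hcap := capacity_le hMα (totalLength D)
  have hword : (D.map fun x => x.length + 1).sum = D.length + totalLength D := by
    have := hlin 1 1
    simpa [add_comm] using this
  rw [hlin] at hins
  have e := ((((MeanLE.const (P := P) ((D.map fun x => x.length + 1).sum + (maxLength D + 1) +
    D.length + ((List.range (maxLength D + 1)).map fun l =>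
      capacity α (countLength D l) + 1).sum + (capacity α (totalLength D) + 1))).add hins).add
    (MeanLE.const ((List.range (maxLength D + 1)).map fun l =>
      1 + capacity α (countLength D l) * (l + 5)).sum)).add
    (MeanLE.const (1 + capacity α (totalLength D) * 5)))
  refine e.mono ?_
  rw [hword]
  have hlen2 : D.length ≤ 2 * totalLength D := by omega
  have hmax2 : maxLength D + 1 ≤ 2 * totalLength D := by omega
  generalize ((List.range (maxLength D + 1)).map fun l =>
      capacity α (countLength D l) + 1).sum = s₁ at *
  generalize ((List.range (maxLength D + 1)).map fun l =>
      1 + capacity α (countLength D l) * (l + 5)).sum = s₂ at *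
  generalize capacity α (totalLength D) = t at *
  generalize D.length = d at *
  generalize maxLength D + 1 = m at *
  generalize totalLength D = n at *
  have hMd := Nat.mul_le_mul_left M hlen2
  have hcd := Nat.mul_le_mul_left c hlen2
  unfold buildConst
  nlinarith

end Costs

/-! ### The bounds for the one-error dictionary -/

/-- Packing with `⌈log₂ σ⌉` bits per character costs at most a factor of two, and so does the
additional character of the longest candidates. -/
theorem packedLength_succ_le {σ w m : ℕ} (hσ : 2 ≤ σ) (hw : 0 < w) (hm : 0 < m) :
    packedLength σ w (m + 1) ≤ 4 * ⌈m * Real.logb 2 σ / w⌉₊ := by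
  set Z := ⌈m * Real.logb 2 σ / w⌉₊ with hZ
  have hw' : (0 : ℝ) < w := by exact_mod_cast hw
  have hlog : 1 ≤ Real.logb 2 σ := by
    rw [Real.le_logb_iff_rpow_le (by norm_num) (by positivity)]
    simpa using (by exact_mod_cast hσ : (2 : ℝ) ≤ σ)
  have hclog : (Nat.clog 2 σ : ℝ) ≤ 2 * Real.logb 2 σ := by
    have h1 : Nat.clog 2 σ = ⌈Real.logb 2 σ⌉₊ := by
      have := Real.natCeil_logb_natCast 2 σ
      exact_mod_cast this.symm
    have := Nat.ceil_lt_add_one (show 0 ≤ Real.logb 2 σ by linarith)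
    rw [h1]; linarith
  have hmZ : m * Real.logb 2 σ ≤ Z * w := by
    rw [← div_le_iff₀ hw']; exact Nat.le_ceil _
  have hm' : (1 : ℝ) ≤ m := by exact_mod_cast hm
  have key : (m + 1) * Nat.clog 2 σ ≤ 4 * Z * w := by
    have : ((m : ℝ) + 1) * Nat.clog 2 σ ≤ 4 * Z * w := by
      calc ((m : ℝ) + 1) * Nat.clog 2 σ ≤ (2 * m) * (2 * Real.logb 2 σ) := by
            gcongr; linarith
        _ = 4 * (m * Real.logb 2 σ) := by ring
        _ ≤ 4 * (Z * w) := by gcongr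
        _ = _ := by ring
    exact_mod_cast this
  unfold packedLength
  refine Nat.lt_succ_iff.1 (Nat.div_lt_of_lt_mul ?_)
  have : w * (4 * Z).succ = 4 * Z * w + w := by rw [Nat.mul_succ, Nat.mul_comm]
  omega

/-- The constant `C` depends only on the load factor, the constants of the model and of the
hashing scheme, and the sampling rate of the rank structure. -/
theorem mainTheorem1 (loadFactor : ℝ) (hα₀ : 0 < loadFactor) (hα₁ : loadFactor < 1)
    (κ : ℝ) (hκ : 0 < κ) (c r δ : ℕ) (hδ : 0 < δ) :
    ∃ C : ℝ, 0 < C ∧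
      ∀ (σ w : ℕ) (D : List (Word σ)) (preCost : Key σ → ℕ) (evalCost : Key σ → Key σ → ℕ)
        (compaction : Bool) (sig : ℕ → Fin (2 ^ r)) (RS : ℕ) (RE : ℕ → ℕ)
        {Ω : Type*} [MeasurableSpace Ω] (P : Measure Ω) [IsProbabilityMeasure P]
        (h : Key σ → Ω → ℕ),
        2 ≤ σ → 0 < w → κ * Real.logb 2 (totalLength D) ≤ w → D.Nodup →
        -- every substitution list has exactly one element
        (∀ u v : Word σ, (substList D u v).Nonempty → (substList D u v).card = 1) →
        IsIncremental c preCost evalCost →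
        -- hash values are reduced without bias modulo the sizes of the tables
        (0 < totalLength D → capacity loadFactor (totalLength D) ∣ RS) →
        (∀ l, 0 < countLength D l → capacity loadFactor (countLength D l) ∣ RE l) →
        FullyRandom P (hashRange RS RE) h →
        let p : Params r := ⟨loadFactor, δ, w, compaction, sig⟩
        let O : Ω → HashOracle σ := fun ω => ⟨fun k => h k ω, preCost, evalCost⟩
        let dict : Ω → OneErrorDict σ r := fun ω => (build p (O ω) D).val
        -- a query returns the dictionary words at edit distance at most one
        (∀ ω x y, y ∈ ((dict ω).query p (O ω) x).val ↔ y ∈ D ∧ EditDistLE 1 x y) ∧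
        -- expected query time
        (∀ x : Word σ, 0 < x.length →
          ∫⁻ ω, (((dict ω).query p (O ω) x).time : ℝ≥0∞) ∂P ≤
            ENNReal.ofReal (C * (x.length * ⌈x.length * Real.logb 2 σ / w⌉₊))) ∧
        -- expected construction time
        (0 < totalLength D →
          ∫⁻ ω, ((build p (O ω) D).time : ℝ≥0∞) ∂P ≤ ENNReal.ofReal (C * totalLength D)) := by
  set ρ := loadFactor * Real.exp (1 - loadFactor) with hρ
  -- `M` bounds the expected length of a run and the number of slots per element
  set M : ℕ := ⌈1 / loadFactor * (1 - ρ)⁻¹ ^ 2⌉₊ + ⌈1 / loadFactor + 1⌉₊ with hM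
  have hM₁ : 1 / loadFactor * (1 - ρ)⁻¹ ^ 2 ≤ M :=
    (Nat.le_ceil _).trans (Nat.cast_le.2 (Nat.le_add_right _ _))
  have hM₂ : 1 / loadFactor + 1 ≤ M :=
    (Nat.le_ceil _).trans (Nat.cast_le.2 (Nat.le_add_left _ _))
  refine ⟨((queryConst M c δ + buildConst M c : ℕ) : ℝ), ?_, ?_⟩
  · have : 0 < queryConst M c δ + buildConst M c := by unfold buildConst; omega
    exact_mod_cast this
  intro σ w D preCost evalCost compaction sig RS RE Ω _ P _ h hσ hw _ hD h1 hinc hRS hRE hh p O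
    dict
  have hz : 0 < p.δ * p.w := Nat.mul_pos hδ hw
  have hbuild : ∀ ω, (build p (O ω) D).Spec (buildCost loadFactor (fun k => h k ω) D c)
      fun Q => Q.IsDictFor (fun k => h k ω) D p := fun ω =>
    build_spec p (O ω) hz hα₀ hα₁ hinc
  have hquery : ∀ ω x, ((dict ω).query p (O ω) x).Spec (queryCost p (fun k => h k ω) D c x)
      fun out => ∀ y, y ∈ out ↔ y ∈ D ∧ EditDistLE 1 x y := fun ω x =>
    OneErrorDict.query_spec (O := O ω) (hbuild ω).1 hδ hα₀ hα₁ hinc x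
  refine ⟨fun ω x y => (hquery ω x).1 y, fun x hx => ?_, fun hn => ?_⟩
  · have hZ : 0 < ⌈x.length * Real.logb 2 σ / w⌉₊ := by
      rw [Nat.ceil_pos]
      have : 0 < Real.logb 2 σ := Real.logb_pos (by norm_num) (by exact_mod_cast hσ)
      have hx' : (0 : ℝ) < x.length := by exact_mod_cast hx
      have hw' : (0 : ℝ) < w := by exact_mod_cast hw
      positivity
    refine (lintegral_mono fun ω => Nat.cast_le.2 (hquery ω x).2).trans
      ((meanLE_queryCost (p := p) hα₀ hα₁ hM₁ hD h1 hRS hRE hh x hx hZ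
        (packedLength_succ_le hσ hw hx)).2.trans ?_)
    rw [← ENNReal.ofReal_natCast]
    refine ENNReal.ofReal_le_ofReal ?_
    push_cast
    gcongr
    exact le_add_of_nonneg_right (Nat.cast_nonneg _)
  · refine (lintegral_mono fun ω => Nat.cast_le.2 (hbuild ω).2).trans
      ((meanLE_buildCost hα₀ hα₁ hM₂ hM₁ hD h1 hRS hRE hh hn).2.trans ?_)
    rw [← ENNReal.ofReal_natCast]
    refine ENNReal.ofReal_le_ofReal ?_
    push_cast
    gcongr
    exact le_add_of_nonneg_left (Nat.cast_nonneg _)
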